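/- Let $n\ge 0$ be an integer, let $\Omega=\mathbb{R}^n\times(0,+\infty)\subset\mathbb{R}^{n+1}$, and identify $\partial\Omega=\mathbb{R}^n\times\{0\}$ with $\mathbb{R}^n$, so that $\mathcal{H}^n$ on $\partial\Omega$ is Lebesgue measure on $\mathbb{R}^n$. For an open set $U\subseteq\mathbb{R}^{n+1}$ put $$\int_U|Du|=\sup\Big\{\int_U u\,\mathrm{div}\,g\,dx:\ g\in C^1_c(U;\mathbb{R}^{n+1}),\ |g|\le 1\Big\},$$ let $BV(U)$ be the set of $u\in L^1(U)$ with $\int_U|Du|<\infty$, let $BV(U,\{0,1\})=\{E\subseteq U:\chi_E\in BV(U)\}$, and write $P(E,U)=\int_U|D\chi_E|$, $P(E)=P(E,\mathbb{R}^{n+1})$. The trace on $\partial\Omega$ of $u\in BV(\Omega)$, again denoted by $u$, is given at $\mathcal{H}^n$-a.e. $x\in\partial\Omega$ by $$u(x)=\lim_{r\to0^+}\frac{1}{|B_r(x)\cap\Omega|}\int_{B_r(x)\cap\Omega}u\,dz .$$ Denote by $\int_{\overline\Omega}|Du|$ the value on $\overline\Omega$ of the total variation measure of the extension of $u$ by zero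 outside $\Omega$, that is, the infimum over open sets $V\supseteq\overline\Omega$ of the total variation of this extension in $V$. Let $\beta\in L^\infty(\partial\Omega)$. For $E\in BV(\Omega,\{0,1\})$ and $u\in BV(\Omega)$ define the capillary functional and its level-set version by $$\mathcal{C}_\beta(E,\Omega)=P(E,\Omega)-\int_{\partial\Omega}\beta\,\chi_E\,d\mathcal{H}^n,\qquad \mathtt{C}_\beta(u,\Omega)=\int_\Omega|Du|-\int_{\partial\Omega}\beta\,u\,d\mathcal{H}^n .$$ (i) If $-1\le\beta\le 1-2\kappa$ $\mathcal{H}^n$-a.e. on $\partial\Omega$ for some $\kappa\in[0,\frac12]$, then for every $E\in BV(\Omega,\{0,1\})$ the limit defining the trace of $\chi_E$ exists $\mathcal{H}^n$-a.e. on $\partial\Omega$, the trace belongs to $L^1(\partial\Omega)$, $P(E)<\infty$, and $$\kappa P(E)\le\mathcal{C}_\beta(E,\Omega)\le P(E).$$ (ii) If $\|\beta\|_{L^\infty(\partial\Omega)}\le 1-2\kappa$ for some $\kappa\in[0,\frac12]$, then for every $u\in BV(\Omega)$ the limit defining the trace of $u$ exists $\mathcal{H}^n$-a.e. on $\partial\Omega$,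 the trace belongs to $L^1(\partial\Omega)$, $\int_{\overline\Omega}|Du|<\infty$, and $$\kappa\int_{\overline\Omega}|Du|\le\mathtt{C}_\beta(u,\Omega)\le\int_{\overline\Omega}|Du|.$$ -/

import Mathlib

open MeasureTheory Set Filter Topology
open scoped ENNReal

noncomputable section

namespace Capillary

/-- The divergence of a vector field on `ℝ^N`. -/
def divergence {N : ℕ} (g : EuclideanSpace ℝ (Fin N) → EuclideanSpace ℝ (Fin N))
    (x : EuclideanSpace ℝ (Fin N)) : ℝ :=
  ∑ i : Fin N, (fderiv ℝ g x (EuclideanSpace.single i 1)) i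

/-- Admissible test fields for the total variation in an open set `U`:
`g ∈ C¹_c(U; ℝ^N)` with `|g| ≤ 1`. -/
def IsTestField {N : ℕ} (U : Set (EuclideanSpace ℝ (Fin N)))
    (g : EuclideanSpace ℝ (Fin N) → EuclideanSpace ℝ (Fin N)) : Prop :=
  ContDiff ℝ 1 g ∧ HasCompactSupport g ∧ tsupport g ⊆ U ∧ ∀ x, ‖g x‖ ≤ 1

/-- The total variation `∫_U |Du| = sup {∫_U u div g : g ∈ C¹_c(U; ℝ^N), |g| ≤ 1}` in an
open set `U`, with values in `[0, ∞]` (`u` is integrable on `U` wherever this is used). -/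
def variation {N : ℕ} (u : EuclideanSpace ℝ (Fin N) → ℝ)
    (U : Set (EuclideanSpace ℝ (Fin N))) : ℝ≥0∞ :=
  ⨆ (g : EuclideanSpace ℝ (Fin N) → EuclideanSpace ℝ (Fin N)) (_ : IsTestField U g),
    ENNReal.ofReal (∫ x in U, u x * divergence g x)

/-- The value `∫_S |Du|` on an arbitrary set `S` of the total variation measure of a function `u`
on `ℝ^N`: the usual outer regular extension from open sets. -/
def variationOn {N : ℕ} (u : EuclideanSpace ℝ (Fin N) → ℝ)
    (S : Set (EuclideanSpace ℝ (Fin N))) : ℝ≥0∞ :=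
  ⨅ (U : Set (EuclideanSpace ℝ (Fin N))) (_ : IsOpen U) (_ : S ⊆ U), variation u U

/-- `u ∈ BV(U)`; only the values of `u` on `U` matter. -/
def MemBV {N : ℕ} (u : EuclideanSpace ℝ (Fin N) → ℝ)
    (U : Set (EuclideanSpace ℝ (Fin N))) : Prop :=
  IntegrableOn u U volume ∧ variation u U < ∞

/-- The characteristic function `χ_E`. -/
def chi {N : ℕ} (E : Set (EuclideanSpace ℝ (Fin N))) : EuclideanSpace ℝ (Fin N) → ℝ :=
  E.indicator (fun _ => (1 : ℝ))

/-- `E ∈ BV(U, {0,1})`: `E ⊆ U` and `χ_E ∈ BV(U)`. -/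
def MemBVSet {N : ℕ} (E U : Set (EuclideanSpace ℝ (Fin N))) : Prop :=
  E ⊆ U ∧ MemBV (chi E) U

/-- The perimeter `P(E, U)` in an open set `U`. -/
def perimeter {N : ℕ} (E U : Set (EuclideanSpace ℝ (Fin N))) : ℝ≥0∞ :=
  variation (chi E) U

/-- The open half-space `Ω = ℝⁿ × (0, ∞)` of `ℝⁿ⁺¹`. -/
def halfSpace (n : ℕ) : Set (EuclideanSpace ℝ (Fin (n + 1))) :=
  {x | 0 < x (Fin.last n)}

/-- The identification `x ↦ (x, 0)` of `ℝⁿ` with `∂Ω = ℝⁿ × {0}`. It is isometric, so the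
(normalised) Hausdorff measure `𝓗ⁿ` on `∂Ω` is Lebesgue measure on `ℝⁿ`. -/
def toBoundary {n : ℕ} (x : EuclideanSpace ℝ (Fin n)) : EuclideanSpace ℝ (Fin (n + 1)) :=
  WithLp.toLp 2 (Fin.snoc (α := fun _ => ℝ) (fun i => x i) 0)

/-- The (interior) trace on `∂Ω ≅ ℝⁿ` of a function on `Ω`: the limit as `r → 0⁺` of the mean
values of `u` over the half-balls `B_r(x) ∩ Ω`. For `u ∈ BV(Ω)` this limit exists for almost
every `x ∈ ∂Ω`. -/
def trace {n : ℕ} (u : EuclideanSpace ℝ (Fin (n + 1)) → ℝ) (x : EuclideanSpace ℝ (Fin n)) : ℝ :=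
  limUnder (𝓝[>] (0 : ℝ))
    (fun r : ℝ => ⨍ z in Metric.ball (toBoundary x) r ∩ halfSpace n, u z)

/-- The trace of `u` is a genuine `L¹(∂Ω)` function: the limit defining it exists almost everywhere
on `∂Ω`, and it is integrable there. -/
def HasIntegrableTrace {n : ℕ} (u : EuclideanSpace ℝ (Fin (n + 1)) → ℝ) : Prop :=
  (∀ᵐ x ∂(volume : Measure (EuclideanSpace ℝ (Fin n))),
    Tendsto (fun r : ℝ => ⨍ z in Metric.ball (toBoundary x) r ∩ halfSpace n, u z)
      (𝓝[>] (0 : ℝ)) (𝓝 (trace u x))) ∧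
  Integrable (trace u) volume

/-- The capillary functional `𝒞_β(E, Ω) = P(E, Ω) - ∫_{∂Ω} β χ_E d𝓗ⁿ`, where on `∂Ω` the
function `χ_E` is the trace of `χ_E`. -/
def capillary {n : ℕ} (β : EuclideanSpace ℝ (Fin n) → ℝ)
    (E : Set (EuclideanSpace ℝ (Fin (n + 1)))) : ℝ :=
  (perimeter E (halfSpace n)).toReal - ∫ x, β x * trace (chi E) x

/-- The level-set capillary functional `C_β(u, Ω) = ∫_Ω |Du| - ∫_{∂Ω} β u d𝓗ⁿ`. -/
def levelSetCapillary {n : ℕ} (β : EuclideanSpace ℝ (Fin n) → ℝ)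
    (u : EuclideanSpace ℝ (Fin (n + 1)) → ℝ) : ℝ :=
  (variation u (halfSpace n)).toReal - ∫ x, β x * trace u x

/-- `∫_{Ω̄} |Du|`: the total variation on the closed half-space of the extension of `u`
by zero outside `Ω`. -/
def closedVariation {n : ℕ} (u : EuclideanSpace ℝ (Fin (n + 1)) → ℝ) : ℝ≥0∞ :=
  variationOn ((halfSpace n).indicator u) (closure (halfSpace n))

end Capillary

end

/-!
A function `u` of bounded variation on the half-space `Ω` has an integrable trace `T` on `∂Ω`, and
two facts about `T` give both chains of inequalities:

* gluing: the extension of `u` by zero has total variation `∫_Ω |Du| + ∫ |T|`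
  (`IsBoundaryValue.variation_univ_le`, `IsBoundaryValue.add_le_variation_univ`);
* the trace inequality of the half-space, with constant one: `∫ |T| ≤ ∫_Ω |Du|`
  (`IsBoundaryValue.integral_abs_le`).

With `V = ∫_Ω |Du|` and `A = ∫ |T|`, the upper bound `V - ∫ β T ≤ V + A` needs `|β| ≤ 1`, or only
`-1 ≤ β` if `T ≥ 0`; the lower bound `κ (V + A) ≤ V - (1 - 2 κ) A` is equivalent to
`0 ≤ (1 - κ) (V - A)`.

The trace is obtained without slicing. Let `T_δ` be a smooth average of `u` in the normal direction
over the layer `(0, δ)`. Writing `u - T_δ` as a normal derivative under duality gives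
`∫_{W × (0, δ)} |u - T_δ| ≤ δ |Du|(W × (0, δ))` for every open `W ⊆ ∂Ω`
(`setIntegral_abs_sub_normalAverage_le`). As `|Du|` of a thin layer is small, the averages converge
in `L¹(∂Ω)` to a function `T` satisfying the same estimate (`exists_boundary_limit`). On the
cylinder `B_r(x) × (0, r)`, the mean distance of `u` to `T(x)` is thus bounded by the
`n`-dimensional density of `|Du|` at `x`, which tends to zero for almost every `x` by the
Besicovitch covering theorem (`ae_tendsto_variation_cylinder_div`), plus a term that
vanishes at Lebesgue points of `T`. Hence the means of `u` over half-balls converge to `T` almost everywhere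
(`ae_tendsto_average_halfBall`).

Only the set function `U ↦ ∫_U |Du|` on open sets is used, through its superadditivity on disjoint
sets (`sum_variation_le`); no measure is constructed from it.
-/

namespace Capillary

/-! ### Cutoff functions and the divergence -/

/-- The cutoff `η` is `1` near `K`, not only on `K`, so that multiplying by `η` changes no
derivative there. -/
theorem exists_smooth_cutoff {F : Type*} [NormedAddCommGroup F] [NormedSpace ℝ F]
    [FiniteDimensional ℝ F] {K O : Set F} (hK : IsCompact K) (hO : IsOpen O) (hKO : K ⊆ O) :
    ∃ η : F → ℝ, ContDiff ℝ 1 η ∧ HasCompactSupport η ∧ tsupport η ⊆ O ∧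
      (∀ x, η x ∈ Icc (0 : ℝ) 1) ∧ ∀ x ∈ K, ∀ᶠ y in 𝓝 x, η y = 1 := by
  have : ProperSpace F := FiniteDimensional.proper ℝ F
  obtain ⟨L, hL, hKL, hLO⟩ := exists_compact_between hK hO hKO
  obtain ⟨f, hf0, hf1, hf⟩ := exists_contMDiffMap_zero_one_nhds_of_isClosed (n := 1)
    (modelWithCornersSelf ℝ F) (s := (interior L)ᶜ) (t := K)
    isOpen_interior.isClosed_compl hK.isClosed
    (disjoint_compl_left_iff_subset.2 hKL)
  have hsub : tsupport f ⊆ L := by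
    refine closure_minimal (fun x hx => ?_) hL.isClosed
    by_contra hxL
    exact hx (hf0.self_of_nhdsSet x (fun h => hxL (interior_subset h)))
  refine ⟨f, f.contMDiff.contDiff, hL.of_isClosed_subset (isClosed_tsupport _) hsub,
    hsub.trans hLO, hf, fun x hx => ?_⟩
  exact (nhds_le_nhdsSet hx) hf1

section Divergence

variable {N : ℕ}

local notation "𝔼" => EuclideanSpace ℝ (Fin N)

theorem continuous_divergence {g : 𝔼 → 𝔼} (hg : ContDiff ℝ 1 g) : Continuous (divergence g) := by
  have h := hg.continuous_fderiv one_ne_zero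
  unfold divergence
  fun_prop

theorem hasCompactSupport_divergence {g : 𝔼 → 𝔼} (hg : HasCompactSupport g) :
    HasCompactSupport (divergence g) := by
  refine (hg.fderiv ℝ).mono fun x hx => ?_
  contrapose! hx
  simp only [Function.mem_support, ne_eq, not_not] at hx ⊢
  simp [divergence, hx]

theorem divergence_eq_zero_of_notMem_tsupport {g : 𝔼 → 𝔼} {x : 𝔼} (hx : x ∉ tsupport g) :
    divergence g x = 0 := by
  have : fderiv ℝ g x = 0 := by
    by_contra h
    exact hx (support_fderiv_subset ℝ h)
  simp [divergence, this]

theorem divergence_congr {g g' : 𝔼 → 𝔼} {x : 𝔼} (h : g =ᶠ[𝓝 x] g') :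
    divergence g x = divergence g' x := by
  simp [divergence, h.fderiv_eq]

theorem divergence_add {g g' : 𝔼 → 𝔼} (hg : ContDiff ℝ 1 g) (hg' : ContDiff ℝ 1 g') (x : 𝔼) :
    divergence (fun y => g y + g' y) x = divergence g x + divergence g' x := by
  have h1 := (hg.differentiable one_ne_zero) x
  have h2 := (hg'.differentiable one_ne_zero) x
  simp [divergence, fderiv_fun_add h1 h2, Finset.sum_add_distrib]

theorem divergence_smul {φ : 𝔼 → ℝ} {g : 𝔼 → 𝔼} (hφ : ContDiff ℝ 1 φ) (hg : ContDiff ℝ 1 g)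
    (x : 𝔼) :
    divergence (fun y => φ y • g y) x = φ x * divergence g x + fderiv ℝ φ x (g x) := by
  have h1 := (hφ.differentiable one_ne_zero) x
  have h2 := (hg.differentiable one_ne_zero) x
  have h3 : g x = ∑ i, g x i • EuclideanSpace.single i (1 : ℝ) := by
    ext j
    simp [Finset.sum_apply, Pi.single_apply]
  have h4 : fderiv ℝ φ x (g x) = ∑ i, g x i * fderiv ℝ φ x (EuclideanSpace.single i 1) := by
    conv_lhs => rw [h3]
    simp
  rw [h4]
  simp [divergence, fderiv_fun_smul h1 h2, Finset.sum_add_distrib, Finset.mul_sum, mul_comm]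

theorem divergence_smul_const {φ : 𝔼 → ℝ} (hφ : ContDiff ℝ 1 φ) (e : 𝔼) (x : 𝔼) :
    divergence (fun y => φ y • e) x = fderiv ℝ φ x e := by
  rw [divergence_smul hφ contDiff_const]
  simp [divergence]

/-! ### The total variation as a set function -/

theorem IsTestField.mono {U V : Set 𝔼} {g : 𝔼 → 𝔼} (h : IsTestField U g) (hUV : U ⊆ V) :
    IsTestField V g :=
  ⟨h.1, h.2.1, h.2.2.1.trans hUV, h.2.2.2⟩

theorem isTestField_zero (U : Set 𝔼) : IsTestField U (0 : 𝔼 → 𝔼) :=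
  ⟨contDiff_const, HasCompactSupport.zero, by simp [tsupport], by simp⟩

/-- Test fields with disjoint supports can be added without violating the bound `|g| ≤ 1`. -/
theorem IsTestField.add {U V : Set 𝔼} {g g' : 𝔼 → 𝔼} (h : IsTestField U g)
    (h' : IsTestField V g') (hd : Disjoint (tsupport g) (tsupport g')) :
    IsTestField (U ∪ V) (fun x => g x + g' x) := by
  refine ⟨h.1.add h'.1, h.2.1.add h'.2.1, ?_, fun x => ?_⟩
  · exact (tsupport_add g g').trans (union_subset_union h.2.2.1 h'.2.2.1)
  · by_cases hx : x ∈ tsupport g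
    · have : g' x = 0 := image_eq_zero_of_notMem_tsupport (disjoint_left.1 hd hx)
      simpa [this] using h.2.2.2 x
    · simpa [image_eq_zero_of_notMem_tsupport hx] using h'.2.2.2 x

theorem integrable_mul_of_hasCompactSupport {X : Type*} [TopologicalSpace X] [MeasurableSpace X]
    [OpensMeasurableSpace X] {μ : Measure X} {w φ : X → ℝ} (hw : Integrable w μ)
    (hφ : Continuous φ) (hc : HasCompactSupport φ) : Integrable (fun x => w x * φ x) μ := by
  obtain ⟨C, hC⟩ := hφ.bounded_above_of_compact_support hc
  exact hw.mul_bdd (c := C) hφ.aestronglyMeasurable (Eventually.of_forall hC)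

theorem IsTestField.integrable {U : Set 𝔼} {g : 𝔼 → 𝔼} (h : IsTestField U g) {w : 𝔼 → ℝ}
    (hw : Integrable w) : Integrable fun x => w x * divergence g x :=
  integrable_mul_of_hasCompactSupport hw (continuous_divergence h.1)
    (hasCompactSupport_divergence h.2.1)

theorem IsTestField.setIntegral_eq {U : Set 𝔼} {g : 𝔼 → 𝔼} (h : IsTestField U g) (w : 𝔼 → ℝ) :
    ∫ x in U, w x * divergence g x = ∫ x, w x * divergence g x := by
  refine setIntegral_eq_integral_of_forall_compl_eq_zero fun x hx => ?_
  rw [divergence_eq_zero_of_notMem_tsupport fun h' => hx (h.2.2.1 h'), mul_zero]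

theorem IsTestField.ofReal_integral_le {U : Set 𝔼} {g : 𝔼 → 𝔼} (h : IsTestField U g)
    (w : 𝔼 → ℝ) : ENNReal.ofReal (∫ x, w x * divergence g x) ≤ variation w U := by
  rw [← h.setIntegral_eq w]
  exact le_iSup₂_of_le g h le_rfl

theorem IsTestField.integral_le {U : Set 𝔼} {g : 𝔼 → 𝔼} (h : IsTestField U g)
    {w : 𝔼 → ℝ} (hfin : variation w U ≠ ∞) :
    ∫ x, w x * divergence g x ≤ (variation w U).toReal :=
  (ENNReal.ofReal_le_iff_le_toReal hfin).1 (h.ofReal_integral_le w)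

theorem variation_le_iff {U : Set 𝔼} {w : 𝔼 → ℝ} {c : ℝ≥0∞} :
    variation w U ≤ c ↔
      ∀ g, IsTestField U g → ENNReal.ofReal (∫ x, w x * divergence g x) ≤ c := by
  refine ⟨fun h g hg => (hg.ofReal_integral_le w).trans h, fun h => iSup₂_le fun g hg => ?_⟩
  rw [hg.setIntegral_eq w]
  exact h g hg

theorem variation_mono (w : 𝔼 → ℝ) {U V : Set 𝔼} (hUV : U ⊆ V) :
    variation w U ≤ variation w V :=
  variation_le_iff.2 fun _ hg => (hg.mono hUV).ofReal_integral_le w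

theorem variation_congr {w w' : 𝔼 → ℝ} {U : Set 𝔼} (hU : MeasurableSet U) (h : EqOn w w' U) :
    variation w U = variation w' U := by
  refine iSup_congr fun g => iSup_congr fun _ => ?_
  rw [setIntegral_congr_fun hU fun x hx => show w x * _ = w' x * divergence g x by rw [h hx]]

theorem exists_isTestField_lt {U : Set 𝔼} {w : 𝔼 → ℝ} (hfin : variation w U ≠ ∞) {ε : ℝ}
    (hε : 0 < ε) :
    ∃ g, IsTestField U g ∧ (variation w U).toReal - ε < ∫ x, w x * divergence g x := by
  by_contra! H
  have h0 : 0 ≤ (variation w U).toReal - ε := by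
    have := H 0 (isTestField_zero U)
    simpa [divergence, fderiv_zero] using this
  have : variation w U ≤ ENNReal.ofReal ((variation w U).toReal - ε) :=
    variation_le_iff.2 fun g hg => ENNReal.ofReal_le_ofReal (H g hg)
  rw [ENNReal.le_ofReal_iff_toReal_le hfin h0] at this
  linarith

/-- The total variation is superadditive on disjoint sets: nearly optimal test fields for the two
sets have disjoint supports, so their sum is again admissible. -/
theorem variation_add_le {U V : Set 𝔼} {w : 𝔼 → ℝ} (hw : Integrable w)
    (hd : Disjoint U V) (hfin : variation w (U ∪ V) ≠ ∞) :
    (variation w U).toReal + (variation w V).toReal ≤ (variation w (U ∪ V)).toReal := by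
  have hU : variation w U ≠ ∞ := ne_top_of_le_ne_top hfin (variation_mono w subset_union_left)
  have hV : variation w V ≠ ∞ := ne_top_of_le_ne_top hfin (variation_mono w subset_union_right)
  refine le_of_forall_pos_le_add fun ε hε => ?_
  obtain ⟨g, hg, h1⟩ := exists_isTestField_lt hU (half_pos hε)
  obtain ⟨g', hg', h2⟩ := exists_isTestField_lt hV (half_pos hε)
  have h3 := (hg.add hg' (hd.mono hg.2.2.1 hg'.2.2.1)).integral_le hfin
  simp only [divergence_add hg.1 hg'.1, mul_add] at h3
  rw [integral_add (hg.integrable hw) (hg'.integrable hw)] at h3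
  linarith

theorem sum_variation_le {ι : Type*} (s : Finset ι) {U : ι → Set 𝔼} {V : Set 𝔼} {w : 𝔼 → ℝ}
    (hw : Integrable w) (hfin : variation w V ≠ ∞) (hUV : ∀ i ∈ s, U i ⊆ V)
    (hd : (s : Set ι).PairwiseDisjoint U) :
    ∑ i ∈ s, (variation w (U i)).toReal ≤ (variation w V).toReal := by
  classical
  suffices h : ∑ i ∈ s, (variation w (U i)).toReal ≤ (variation w (⋃ i ∈ s, U i)).toReal from
    h.trans (ENNReal.toReal_mono hfin (variation_mono w (iUnion₂_subset hUV)))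
  induction s using Finset.induction_on with
  | empty => simp
  | insert a s ha ih =>
    rw [Finset.sum_insert ha, Finset.set_biUnion_insert]
    have h1 := ih (fun i hi => hUV i (Finset.mem_insert_of_mem hi))
      (hd.subset (by simp))
    have hsub : U a ∪ ⋃ i ∈ s, U i ⊆ V :=
      union_subset (hUV a (Finset.mem_insert_self a s))
        (iUnion₂_subset fun i hi => hUV i (Finset.mem_insert_of_mem hi))
    have hdis : Disjoint (U a) (⋃ i ∈ s, U i) := by
      rw [disjoint_iUnion₂_right]
      intro i hi
      exact hd (by simp) (by simp [hi]) (fun h => ha (h ▸ hi))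
    have h2 := variation_add_le hw hdis (ne_top_of_le_ne_top hfin (variation_mono w hsub))
    linarith

end Divergence

/-! ### Duality for the `L¹` norm -/

/-- The `L¹` norm over an open set is a supremum over `C¹` functions with compact support: up to
a set of small `|f| μ`-measure, the positivity and negativity sets of `f` are compact, and the
sign of `f` is then the difference of two cutoff functions. -/
theorem integral_abs_le_of_forall_contDiff {F : Type*} [NormedAddCommGroup F] [NormedSpace ℝ F]
    [FiniteDimensional ℝ F] [MeasurableSpace F] [BorelSpace F] {μ : Measure F} {O : Set F}
    (hO : IsOpen O) {f : F → ℝ} (hf : IntegrableOn f O μ) {C : ℝ}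
    (h : ∀ H : F → ℝ, ContDiff ℝ 1 H → HasCompactSupport H → tsupport H ⊆ O → (∀ x, |H x| ≤ 1) →
      ∫ x in O, f x * H x ∂μ ≤ C) :
    ∫ x in O, |f x| ∂μ ≤ C := by
  have : ProperSpace F := FiniteDimensional.proper ℝ F
  wlog hfm : StronglyMeasurable f generalizing f
  · have hae := hf.aestronglyMeasurable.ae_eq_mk
    have := this (f := hf.aestronglyMeasurable.mk f) (hf.congr_fun_ae hae) ?_
      hf.aestronglyMeasurable.stronglyMeasurable_mk
    · refine le_of_eq_of_le (integral_congr_ae ?_) this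
      filter_upwards [hae] with x hx
      rw [hx]
    · intro H h1 h2 h3 h4
      refine le_of_eq_of_le (integral_congr_ae ?_) (h H h1 h2 h3 h4)
      filter_upwards [hae] with x hx
      rw [hx]
  set ν : Measure F := (μ.restrict O).withDensity fun x => ‖f x‖ₑ with hν
  have : IsFiniteMeasure ν := isFiniteMeasure_withDensity hf.2.ne
  have hfi : Integrable (fun x => |f x|) (μ.restrict O) := hf.abs
  have key : ∀ s, MeasurableSet s → ∫ x in O, s.indicator (fun x => |f x|) x ∂μ = (ν s).toReal := by
    intro s hs
    rw [integral_indicator hs, hν, withDensity_apply _ hs]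
    exact integral_norm_eq_lintegral_enorm hfm.aestronglyMeasurable
  refine le_of_forall_pos_le_add fun ε hε => ?_
  have hε4 : ENNReal.ofReal (ε / 4) ≠ 0 := by simpa using by positivity
  have hAp : MeasurableSet (O ∩ {x | 0 < f x}) :=
    hO.measurableSet.inter (measurableSet_lt measurable_const hfm.measurable)
  have hAn : MeasurableSet (O ∩ {x | f x < 0}) :=
    hO.measurableSet.inter (measurableSet_lt hfm.measurable measurable_const)
  obtain ⟨Kp, hKpA, hKp, hνp⟩ := hAp.exists_isCompact_sdiff_lt (measure_ne_top ν _) hε4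
  obtain ⟨Kn, hKnA, hKn, hνn⟩ := hAn.exists_isCompact_sdiff_lt (measure_ne_top ν _) hε4
  have hdisj : ∀ x ∈ Kp, x ∉ Kn := fun x hx hx' =>
    lt_asymm (show 0 < f x from (hKpA hx).2) (hKnA hx').2
  obtain ⟨ηp, hp1, hp2, hp3, hp4, hp5⟩ := exists_smooth_cutoff (O := O \ Kn) hKp
    (hO.sdiff hKn.isClosed) fun x hx => ⟨(hKpA hx).1, hdisj x hx⟩
  obtain ⟨ηn, hn1, hn2, hn3, hn4, hn5⟩ := exists_smooth_cutoff (O := O \ Kp) hKn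
    (hO.sdiff hKp.isClosed) fun x hx => ⟨(hKnA hx).1, fun hx' => hdisj x hx' hx⟩
  have hH := h (fun x => ηp x - ηn x) (hp1.sub hn1) (hp2.sub hn2)
    ((tsupport_sub ηp ηn).trans (union_subset (hp3.trans sdiff_subset) (hn3.trans sdiff_subset)))
    fun x => by
      rw [abs_le]
      have := hp4 x
      have := hn4 x
      simp only [mem_Icc] at *
      constructor <;> linarith
  have hle : ∀ x ∈ O, |f x| - 2 * (((O ∩ {x | 0 < f x}) \ Kp).indicator (fun x => |f x|) x
      + ((O ∩ {x | f x < 0}) \ Kn).indicator (fun x => |f x|) x) ≤ f x * (ηp x - ηn x) := by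
    intro x hx
    have b1 := hp4 x
    have b2 := hn4 x
    have e1 : x ∈ Kp → ηp x = 1 ∧ ηn x = 0 := fun hxp =>
      ⟨(hp5 x hxp).self_of_nhds, image_eq_zero_of_notMem_tsupport fun h' => (hn3 h').2 hxp⟩
    have e2 : x ∈ Kn → ηn x = 1 ∧ ηp x = 0 := fun hxn =>
      ⟨(hn5 x hxn).self_of_nhds, image_eq_zero_of_notMem_tsupport fun h' => (hp3 h').2 hxn⟩
    simp only [mem_Icc] at b1 b2
    rcases lt_trichotomy (f x) 0 with hneg | hz | hpos
    · have : ¬ (0 < f x) := not_lt.2 hneg.le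
      by_cases hk : x ∈ Kn
      · simp [hk, this, e2 hk, abs_of_neg hneg]
      · simp [hk, this, hx, hneg, abs_of_neg hneg]
        nlinarith
    · simp [hz]
    · have : ¬ (f x < 0) := not_lt.2 hpos.le
      by_cases hk : x ∈ Kp
      · simp [hk, this, e1 hk, abs_of_pos hpos]
      · simp [hk, this, hx, hpos, abs_of_pos hpos]
        nlinarith
  have hmp := hAp.diff hKp.measurableSet
  have hmn := hAn.diff hKn.measurableSet
  have i1 := hfi.indicator hmp
  have i2 := hfi.indicator hmn
  have i3 : Integrable (fun x => f x * (ηp x - ηn x)) (μ.restrict O) :=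
    integrable_mul_of_hasCompactSupport hf (hp1.continuous.sub hn1.continuous) (hp2.sub hn2)
  have hint := setIntegral_mono_on (hfi.sub ((i1.add i2).const_mul 2)) i3 hO.measurableSet hle
  simp only [Pi.sub_apply, Pi.add_apply] at hint
  rw [integral_sub hfi (by exact (i1.add i2).const_mul 2), integral_const_mul,
    integral_add i1 i2, key _ hmp, key _ hmn] at hint
  have t1 : (ν ((O ∩ {x | 0 < f x}) \ Kp)).toReal ≤ ε / 4 :=
    ENNReal.toReal_le_of_le_ofReal (by positivity) hνp.le
  have t2 : (ν ((O ∩ {x | f x < 0}) \ Kn)).toReal ≤ ε / 4 :=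
    ENNReal.toReal_le_of_le_ofReal (by positivity) hνn.le
  linarith

/-! ### Normal profiles -/

/-- A smooth nondecreasing profile which is `0` on `(-∞, 1/4]` and `1` on `[3/4, ∞)`. -/
noncomputable def profile (t : ℝ) : ℝ := Real.smoothTransition (2 * t - 1 / 2)

theorem contDiff_profile : ContDiff ℝ 1 profile :=
  Real.smoothTransition.contDiff.comp (f := fun t : ℝ => 2 * t - 1 / 2) (by fun_prop)

theorem profile_mem_Icc (t : ℝ) : profile t ∈ Icc (0 : ℝ) 1 :=
  ⟨Real.smoothTransition.nonneg _, Real.smoothTransition.le_one _⟩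

theorem profile_of_le {t : ℝ} (ht : t ≤ 1 / 4) : profile t = 0 :=
  Real.smoothTransition.zero_of_nonpos (by linarith)

theorem profile_of_ge {t : ℝ} (ht : 3 / 4 ≤ t) : profile t = 1 :=
  Real.smoothTransition.one_of_one_le (by linarith)

theorem monotone_profile : Monotone profile := fun _ _ h =>
  Real.smoothTransition.monotone (by linarith)

theorem deriv_profile_nonneg (t : ℝ) : 0 ≤ deriv profile t := monotone_profile.deriv_nonneg

theorem deriv_profile_eq_zero {t : ℝ} (ht : t ∉ Icc (1 / 4 : ℝ) (3 / 4)) :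
    deriv profile t = 0 := by
  rcases lt_or_ge t (1 / 4) with h | h
  · have : profile =ᶠ[𝓝 t] fun _ => 0 := by
      filter_upwards [Iio_mem_nhds h] with s hs using profile_of_le (le_of_lt hs)
    rw [this.deriv_eq, deriv_const]
  · have h' : 3 / 4 < t := by
      by_contra h'
      exact ht ⟨h, not_lt.1 h'⟩
    have : profile =ᶠ[𝓝 t] fun _ => 1 := by
      filter_upwards [Ioi_mem_nhds h'] with s hs using profile_of_ge (le_of_lt hs)
    rw [this.deriv_eq, deriv_const]

theorem continuous_deriv_profile : Continuous (deriv profile) :=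
  contDiff_profile.continuous_deriv le_rfl

theorem exists_deriv_profile_le : ∃ C, 0 < C ∧ ∀ t, deriv profile t ≤ C := by
  have hc : HasCompactSupport (deriv profile) :=
    HasCompactSupport.of_support_subset_isCompact isCompact_Icc fun t ht => by
      by_contra h
      exact ht (deriv_profile_eq_zero h)
  obtain ⟨C, hC⟩ := continuous_deriv_profile.bounded_above_of_compact_support hc
  exact ⟨max C 1, by positivity, fun t =>
    (le_abs_self _).trans ((hC t).trans (le_max_left _ _))⟩

/-- The profile rescaled to the interval `(0, δ)`. -/
noncomputable def scaledProfile (δ t : ℝ) : ℝ := profile (t / δ)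

theorem contDiff_scaledProfile (δ : ℝ) : ContDiff ℝ 1 (scaledProfile δ) :=
  contDiff_profile.comp (f := fun t : ℝ => t / δ) (by fun_prop)

theorem scaledProfile_mem_Icc (δ t : ℝ) : scaledProfile δ t ∈ Icc (0 : ℝ) 1 := profile_mem_Icc _

theorem scaledProfile_of_le {δ t : ℝ} (hδ : 0 < δ) (ht : t ≤ δ / 4) : scaledProfile δ t = 0 :=
  profile_of_le ((div_le_iff₀ hδ).2 (by linarith))

theorem scaledProfile_of_ge {δ t : ℝ} (hδ : 0 < δ) (ht : 3 * δ / 4 ≤ t) : scaledProfile δ t = 1 :=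
  profile_of_ge ((le_div_iff₀ hδ).2 (by linarith))

theorem deriv_scaledProfile (δ t : ℝ) :
    deriv (scaledProfile δ) t = deriv profile (t / δ) / δ := by
  have h : HasDerivAt profile (deriv profile (t / δ)) (t / δ) :=
    (contDiff_profile.differentiable one_ne_zero _).hasDerivAt
  have h2 := h.comp t ((hasDerivAt_id t).div_const δ)
  have e : scaledProfile δ = fun t => profile (t / δ) := rfl
  simpa [e, div_eq_mul_inv, Function.comp_def] using h2.deriv

theorem deriv_scaledProfile_nonneg {δ : ℝ} (hδ : 0 < δ) (t : ℝ) :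
    0 ≤ deriv (scaledProfile δ) t := by
  rw [deriv_scaledProfile]
  exact div_nonneg (deriv_profile_nonneg _) hδ.le

theorem deriv_scaledProfile_eq_zero {δ t : ℝ} (hδ : 0 < δ) (ht : t ∉ Icc (δ / 4) (3 * δ / 4)) :
    deriv (scaledProfile δ) t = 0 := by
  rw [deriv_scaledProfile, deriv_profile_eq_zero, zero_div]
  contrapose! ht
  rw [mem_Icc, le_div_iff₀ hδ, div_le_iff₀ hδ] at ht
  constructor <;> linarith [ht.1, ht.2]

theorem continuous_deriv_scaledProfile (δ : ℝ) : Continuous (deriv (scaledProfile δ)) :=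
  (contDiff_scaledProfile δ).continuous_deriv le_rfl

theorem hasCompactSupport_deriv_scaledProfile {δ : ℝ} (hδ : 0 < δ) :
    HasCompactSupport (deriv (scaledProfile δ)) :=
  HasCompactSupport.of_support_subset_isCompact (K := Icc (δ / 4) (3 * δ / 4)) isCompact_Icc
    fun t ht => by
      by_contra h
      exact ht (deriv_scaledProfile_eq_zero hδ h)

theorem integral_deriv_scaledProfile {δ δ' : ℝ} (hδ : 0 < δ) (hδ' : δ ≤ δ') :
    ∫ t in Ioo 0 δ', deriv (scaledProfile δ) t = 1 := by
  have h : ∀ t ∈ uIcc 0 δ', DifferentiableAt ℝ (scaledProfile δ) t := fun t _ =>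
    (contDiff_scaledProfile δ).differentiable one_ne_zero t
  have := intervalIntegral.integral_deriv_eq_sub h
    ((continuous_deriv_scaledProfile δ).intervalIntegrable _ _)
  rw [intervalIntegral.integral_of_le (by linarith), integral_Ioc_eq_integral_Ioo] at this
  rw [this, scaledProfile_of_ge hδ (by linarith), scaledProfile_of_le hδ (by linarith), sub_zero]

/-! ### Averaging in the normal direction -/

theorem fderiv_prod_apply_zero_one {X : Type*} [NormedAddCommGroup X] [NormedSpace ℝ X]
    {Ψ : X × ℝ → ℝ} (hΨ : ContDiff ℝ 1 Ψ) {x : X} {t d : ℝ}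
    (h : HasDerivAt (fun s => Ψ (x, s)) d t) : fderiv ℝ Ψ (x, t) (0, 1) = d := by
  have h1 : HasFDerivAt Ψ (fderiv ℝ Ψ (x, t)) (x, t) :=
    (hΨ.differentiable one_ne_zero _).hasFDerivAt
  have h2 : HasDerivAt (fun s : ℝ => (x, s)) ((0 : X), (1 : ℝ)) t :=
    (hasDerivAt_const t x).prodMk (hasDerivAt_id t)
  exact (h1.comp_hasDerivAt t h2).unique h

section Measure

variable {X : Type*} [MeasurableSpace X] {μ : Measure X} [SigmaFinite μ]

theorem integrableOn_comp_fst {T : X → ℝ} (hT : Integrable T μ) (W : Set X) (δ : ℝ) :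
    IntegrableOn (fun p : X × ℝ => T p.1) (W ×ˢ Ioo 0 δ) (μ.prod volume) := by
  rw [IntegrableOn, ← Measure.prod_restrict]
  exact hT.restrict.comp_fst _

theorem setIntegral_comp_fst {T : X → ℝ} (W : Set X) {δ : ℝ} (hδ : 0 ≤ δ) :
    ∫ p in W ×ˢ Ioo 0 δ, T p.1 ∂(μ.prod (volume : Measure ℝ)) = δ * ∫ x in W, T x ∂μ := by
  rw [← Measure.prod_restrict, integral_fun_fst]
  simp [hδ]

end Measure

/-- The average of `v` in the last variable over `(0, δ)`, weighted by the derivative of the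
profile. -/
noncomputable def normalAverage {X : Type*} (v : X × ℝ → ℝ) (δ : ℝ) (x : X) : ℝ :=
  ∫ t, v (x, t) * deriv (scaledProfile δ) t

theorem integrable_mul_deriv_scaledProfile {X : Type*} [TopologicalSpace X] [MeasurableSpace X]
    [BorelSpace X] {v : X × ℝ → ℝ} {ν : Measure (X × ℝ)} (hv : Integrable v ν) {δ : ℝ}
    (hδ : 0 < δ) : Integrable (fun p : X × ℝ => v p * deriv (scaledProfile δ) p.2) ν := by
  obtain ⟨C, hC⟩ := (continuous_deriv_scaledProfile δ).bounded_above_of_compact_support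
    (hasCompactSupport_deriv_scaledProfile hδ)
  exact hv.mul_bdd (c := C)
    ((continuous_deriv_scaledProfile δ).comp continuous_snd).aestronglyMeasurable
    (Eventually.of_forall fun p => hC p.2)

theorem integrable_normalAverage {X : Type*} [TopologicalSpace X] [MeasurableSpace X]
    [BorelSpace X] {μ : Measure X} [SFinite μ] {v : X × ℝ → ℝ}
    (hv : Integrable v (μ.prod volume)) {δ : ℝ} (hδ : 0 < δ) : Integrable (normalAverage v δ) μ :=
  (integrable_mul_deriv_scaledProfile hv hδ).integral_prod_left

section Slab

variable {X : Type*} [NormedAddCommGroup X] [NormedSpace ℝ X]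

theorem contDiff_intervalIntegral_snd {H : X × ℝ → ℝ} (hH : ContDiff ℝ 1 H)
    (hc : HasCompactSupport H) (h0 : ∀ x, ∀ t ≤ 0, H (x, t) = 0) :
    ContDiff ℝ 1 fun p : X × ℝ => ∫ s in (0 : ℝ)..p.2, H (p.1, s) := by
  have hf : LocallyIntegrable ((Ioi (0 : ℝ)).indicator fun _ => (1 : ℝ)) :=
    (locallyIntegrable_const 1).indicator measurableSet_Ioi
  have hk : IsCompact (Prod.snd '' tsupport H) := hc.image continuous_snd
  have hgs : ∀ (x : X) (t : ℝ), x ∈ univ → t ∉ Prod.snd '' tsupport H → H (x, t) = 0 := by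
    intro x t _ ht
    exact image_eq_zero_of_notMem_tsupport fun h => ht ⟨_, h, rfl⟩
  -- the primitive is the convolution in the last variable with the Heaviside function
  have hconv := contDiffOn_convolution_right_with_param (μ := volume) (n := 1)
    (ContinuousLinearMap.mul ℝ ℝ) (g := fun (x : X) (t : ℝ) => H (x, t)) isOpen_univ hk hgs hf
    hH.contDiffOn
  rw [univ_prod_univ, contDiffOn_univ] at hconv
  convert hconv using 1
  · rfl
  ext ⟨x, t⟩
  simp only [convolution, ContinuousLinearMap.mul_apply']
  rw [← integral_sub_left_eq_self _ _ t]
  have e1 : ∀ s, (Ioi (0 : ℝ)).indicator (fun _ => (1 : ℝ)) (t - s) * H (x, t - (t - s))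
      = (Ioo 0 t).indicator (fun s => H (x, s)) s := by
    intro s
    by_cases h1 : s < t
    · by_cases h2 : 0 < s
      · simp [h1, h2]
      · simp [h2, h0 x s (not_lt.1 h2)]
    · simp [h1]
  simp only [e1]
  rw [integral_indicator measurableSet_Ioo]
  rcases le_total 0 t with ht | ht
  · rw [intervalIntegral.integral_of_le ht, integral_Ioc_eq_integral_Ioo]
  · rw [intervalIntegral.integral_of_ge ht, Ioo_eq_empty (not_lt.2 ht)]
    simp only [Measure.restrict_empty, integral_zero_measure, neg_eq_zero]
    exact setIntegral_eq_zero_of_forall_eq_zero fun s hs => h0 x s hs.2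

variable [FiniteDimensional ℝ X] [MeasurableSpace X] [BorelSpace X] {μ : Measure X} [SigmaFinite μ]

/-- If the normal derivative of `v` has mass at most `M` in the slab `W × (0, δ)`, then `v` is
at `L¹` distance at most `δ M` from any of its normal averages. By duality this is a bound for
`∫ (v - T) H = ∫ v ∂ₜΨ`, where `Ψ(x, ·)` is the primitive of `H(x, ·) - ρ ∫ H(x, s) ds`, with `ρ`
the weight of the average; `|Ψ| ≤ δ` whenever `|H| ≤ 1`. -/
theorem setIntegral_abs_sub_normalAverage_le {v : X × ℝ → ℝ} (hv : Integrable v (μ.prod volume))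
    {W : Set X} (hW : IsOpen W) {δ δ' : ℝ} (hδ' : 0 < δ') (hδ : δ' ≤ δ) {M : ℝ}
    (hM : ∀ Ψ : X × ℝ → ℝ, ContDiff ℝ 1 Ψ → HasCompactSupport Ψ → tsupport Ψ ⊆ W ×ˢ Ioo 0 δ →
      (∀ p, |Ψ p| ≤ 1) → ∫ p, v p * fderiv ℝ Ψ p (0, 1) ∂(μ.prod volume) ≤ M) :
    ∫ p in W ×ˢ Ioo 0 δ, |v p - normalAverage v δ' p.1| ∂(μ.prod volume) ≤ δ * M := by
  have hδ0 : 0 < δ := hδ'.trans_le hδ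
  refine integral_abs_le_of_forall_contDiff (hW.prod isOpen_Ioo) (hv.integrableOn.sub
    (integrableOn_comp_fst (integrable_normalAverage hv hδ') W δ)) ?_
  intro H hH1 hHc hHs hHb
  have hH0 : ∀ x t, t ∉ Ioo 0 δ → H (x, t) = 0 := fun x t ht =>
    image_eq_zero_of_notMem_tsupport fun h => ht (hHs h).2
  have hHcont : ∀ x, Continuous fun s => H (x, s) := fun x =>
    hH1.continuous.comp (by fun_prop)
  set G : X × ℝ → ℝ := fun p => ∫ s in (0 : ℝ)..p.2, H (p.1, s) with hG
  have hG1 : ContDiff ℝ 1 G := contDiff_intervalIntegral_snd hH1 hHc fun x t ht =>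
    hH0 x t fun h => not_lt.2 ht h.1
  have hGδ : ∀ x t, δ ≤ t → G (x, t) = G (x, δ) := by
    intro x t ht
    have : ∫ s in δ..t, H (x, s) = 0 := by
      refine intervalIntegral.integral_zero_ae (Eventually.of_forall fun s hs => ?_)
      rw [uIoc_of_le ht] at hs
      exact hH0 x s fun h => lt_asymm h.2 hs.1
    have h2 := intervalIntegral.integral_add_adjacent_intervals (μ := volume)
      ((hHcont x).intervalIntegrable 0 δ) ((hHcont x).intervalIntegrable δ t)
    simp only [hG]
    rw [← h2, this, add_zero]
  have hGint : ∀ x, ∫ s, H (x, s) = G (x, δ) := by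
    intro x
    simp only [hG]
    rw [intervalIntegral.integral_of_le hδ0.le, integral_Ioc_eq_integral_Ioo,
      setIntegral_eq_integral_of_forall_compl_eq_zero (hH0 x)]
  have hHb' : ∀ (x : X) (a b : ℝ), |∫ s in a..b, H (x, s)| ≤ |b - a| := by
    intro x a b
    simpa using intervalIntegral.norm_integral_le_of_norm_le_const (a := a) (b := b) (C := 1)
      (f := fun s => H (x, s)) fun s _ => hHb (x, s)
  set P := scaledProfile δ' with hP
  set Ψ : X × ℝ → ℝ := fun p => G p - P p.2 * G (p.1, δ) with hΨ
  have hΨ1 : ContDiff ℝ 1 Ψ :=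
    hG1.sub (((contDiff_scaledProfile δ').comp contDiff_snd).mul
      (hG1.comp (contDiff_fst.prodMk contDiff_const)))
  have hderiv : ∀ p : X × ℝ,
      fderiv ℝ Ψ p (0, 1) = H p - deriv P p.2 * G (p.1, δ) := by
    rintro ⟨x, t⟩
    refine fderiv_prod_apply_zero_one hΨ1 ?_
    have h1 : HasDerivAt (fun s => G (x, s)) (H (x, t)) t :=
      (hHcont x).integral_hasStrictDerivAt 0 t |>.hasDerivAt
    have h2 : HasDerivAt P (deriv P t) t :=
      ((contDiff_scaledProfile δ').differentiable one_ne_zero t).hasDerivAt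
    exact h1.sub (h2.mul_const (G (x, δ)))
  -- `Ψ(x, ·)` vanishes near `0`, where `G` and `P` do, and near `δ`, where `P = 1`
  set K' : Set X := Prod.fst '' tsupport H with hK'
  have hK'c : IsCompact K' := hHc.image continuous_fst
  have hGK : ∀ x ∉ K', ∀ t, G (x, t) = 0 := by
    intro x hx t
    have : ∀ s, H (x, s) = 0 := fun s =>
      image_eq_zero_of_notMem_tsupport fun h => hx ⟨_, h, rfl⟩
    simp [hG, this]
  obtain ⟨a, ha0, haδ, hab⟩ : ∃ a, 0 < a ∧ a ≤ δ' / 4 ∧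
      ∀ x t, t ∉ Icc a (δ - a) → H (x, t) = 0 := by
    have hKc : IsCompact (Prod.snd '' tsupport H) := hHc.image continuous_snd
    have hKs : Prod.snd '' tsupport H ⊆ Ioo 0 δ := by
      rintro _ ⟨p, hp, rfl⟩
      exact (hHs hp).2
    rcases (Prod.snd '' tsupport H).eq_empty_or_nonempty with he | hne
    · refine ⟨δ' / 4, by positivity, le_rfl, fun x t _ => ?_⟩
      refine image_eq_zero_of_notMem_tsupport fun h => ?_
      exact (he ▸ mem_image_of_mem Prod.snd h : _ ∈ (∅ : Set ℝ))
    · obtain ⟨m, hm, hmin⟩ := hKc.exists_isMinOn hne continuousOn_id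
      obtain ⟨m', hm', hmax⟩ := hKc.exists_isMaxOn hne continuousOn_id
      refine ⟨min (δ' / 4) (min m (δ - m')), ?_, min_le_left _ _, fun x t ht => ?_⟩
      · have := (hKs hm).1
        have := (hKs hm').2
        refine lt_min (by positivity) (lt_min (by assumption) (by linarith))
      · refine image_eq_zero_of_notMem_tsupport fun h => ht ?_
        have h1 : m ≤ t := hmin (mem_image_of_mem Prod.snd h)
        have h2 : t ≤ m' := hmax (mem_image_of_mem Prod.snd h)
        have h3 : min (δ' / 4) (min m (δ - m')) ≤ m :=
          (min_le_right _ _).trans (min_le_left _ _)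
        have h4 : min (δ' / 4) (min m (δ - m')) ≤ δ - m' :=
          (min_le_right _ _).trans (min_le_right _ _)
        exact ⟨by linarith, by linarith⟩
  have hΨsub : Function.support Ψ ⊆ K' ×ˢ Icc a (δ - a) := by
    rintro ⟨x, t⟩ hxt
    by_contra hn
    apply hxt
    by_cases hx : x ∈ K'
    · have ht : t ∉ Icc a (δ - a) := fun ht => hn ⟨hx, ht⟩
      rcases lt_or_ge t a with h | h
      · have e1 : P t = 0 := scaledProfile_of_le hδ' (by linarith)
        have e2 : G (x, t) = 0 := by
          refine intervalIntegral.integral_zero_ae (Eventually.of_forall fun s hs => ?_)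
          refine hab x s fun hs' => ?_
          rcases le_total 0 t with h0 | h0
          · rw [uIoc_of_le h0] at hs
            exact absurd hs'.1 (not_le.2 (hs.2.trans_lt h))
          · rw [uIoc_of_ge h0] at hs
            linarith [hs.2, hs'.1]
        simp [hΨ, e1, e2]
      · have h' : δ - a < t := by
          by_contra h'
          exact ht ⟨h, not_lt.1 h'⟩
        have e1 : P t = 1 := scaledProfile_of_ge hδ' (by linarith)
        have e2 : G (x, t) = G (x, δ) := by
          rcases le_total δ t with h0 | h0
          · exact hGδ x t h0
          · have : ∫ s in t..δ, H (x, s) = 0 := by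
              refine intervalIntegral.integral_zero_ae (Eventually.of_forall fun s hs => ?_)
              rw [uIoc_of_le h0] at hs
              exact hab x s fun hs' => by linarith [hs.1, hs'.2]
            have h2 := intervalIntegral.integral_add_adjacent_intervals (μ := volume)
              ((hHcont x).intervalIntegrable 0 t) ((hHcont x).intervalIntegrable t δ)
            simp only [hG]
            rw [← h2, this, add_zero]
        simp [hΨ, e1, e2]
    · simp [hΨ, hGK x hx]
  have hKcc : IsCompact (K' ×ˢ Icc a (δ - a)) := hK'c.prod isCompact_Icc
  have hΨt : tsupport Ψ ⊆ K' ×ˢ Icc a (δ - a) := closure_minimal hΨsub hKcc.isClosed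
  have hΨc : HasCompactSupport Ψ := hKcc.of_isClosed_subset (isClosed_tsupport _) hΨt
  have hΨs : tsupport Ψ ⊆ W ×ˢ Ioo 0 δ := by
    refine hΨt.trans (prod_mono ?_ fun t ht => ⟨by linarith [ht.1], by linarith [ht.2]⟩)
    rintro _ ⟨p, hp, rfl⟩
    exact (hHs hp).1
  have hΨb : ∀ p, |Ψ p| ≤ δ := by
    rintro ⟨x, t⟩
    by_cases hxt : Ψ (x, t) = 0
    · simp [hxt, hδ0.le]
    have ht : t ∈ Icc a (δ - a) := (hΨsub (show (x, t) ∈ Function.support Ψ from hxt)).2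
    have b1 := hHb' x 0 t
    have b2 := hHb' x t δ
    have h2 := intervalIntegral.integral_add_adjacent_intervals (μ := volume)
      ((hHcont x).intervalIntegrable 0 t) ((hHcont x).intervalIntegrable t δ)
    have hp := scaledProfile_mem_Icc δ' t
    rw [abs_of_nonneg (by linarith [ht.1] : (0 : ℝ) ≤ t - 0)] at b1
    rw [abs_of_nonneg (by linarith [ht.2] : (0 : ℝ) ≤ δ - t)] at b2
    simp only [hΨ, hG]
    rw [← h2]
    -- `Ψ = (1 - P) ∫₀ᵗ H - P ∫ₜ^δ H`, with `0 ≤ P ≤ 1`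
    rw [abs_le] at b1 b2 ⊢
    simp only [mem_Icc] at hp ht
    change -δ ≤ _ - scaledProfile δ' t * _ ∧ _ - scaledProfile δ' t * _ ≤ δ
    constructor <;>
    nlinarith [mul_nonneg hp.1 (sub_nonneg.2 b2.1), mul_nonneg hp.1 (sub_nonneg.2 b2.2),
      mul_nonneg (sub_nonneg.2 hp.2) (sub_nonneg.2 b1.1),
      mul_nonneg (sub_nonneg.2 hp.2) (sub_nonneg.2 b1.2),
      mul_nonneg hp.1 (by linarith : (0 : ℝ) ≤ t),
      mul_nonneg (sub_nonneg.2 hp.2) (by linarith : (0 : ℝ) ≤ δ - t)]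
  -- the test function `Ψ / δ`
  have hmain := hM (fun p => δ⁻¹ * Ψ p) (contDiff_const.mul hΨ1) (hΨc.mul_left)
    ((tsupport_mul_subset_right (f := fun _ => δ⁻¹) (g := Ψ)).trans hΨs) fun p => by
      rw [abs_mul, abs_of_pos (inv_pos.2 hδ0), inv_mul_le_iff₀ hδ0, mul_one]
      exact hΨb p
  have hfd : ∀ p, fderiv ℝ (fun p => δ⁻¹ * Ψ p) p (0, 1)
      = δ⁻¹ * (H p - deriv P p.2 * G (p.1, δ)) := by
    intro p
    rw [fderiv_const_mul (hΨ1.differentiable one_ne_zero p)]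
    simp [hderiv]
  simp only [hfd, mul_left_comm _ δ⁻¹] at hmain
  rw [integral_const_mul, inv_mul_le_iff₀ hδ0] at hmain
  refine le_of_eq_of_le ?_ hmain
  -- both sides equal `∫ v H - ∫ T G(·, δ)`
  have iH : Integrable (fun p => v p * H p) (μ.prod volume) :=
    integrable_mul_of_hasCompactSupport hv hH1.continuous hHc
  have hGb : ∀ x, |G (x, δ)| ≤ δ := fun x => by
    simpa [abs_of_pos hδ0] using hHb' x 0 δ
  have hGc : Continuous fun p : X × ℝ => G (p.1, δ) :=
    hG1.continuous.comp (by fun_prop)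
  have iG : Integrable (fun p : X × ℝ => (v p * deriv P p.2) * G (p.1, δ)) (μ.prod volume) :=
    (integrable_mul_deriv_scaledProfile hv hδ').mul_bdd (c := δ) hGc.aestronglyMeasurable
      (Eventually.of_forall fun p => hGb p.1)
  have iTH : IntegrableOn (fun p : X × ℝ => normalAverage v δ' p.1 * H p) (W ×ˢ Ioo 0 δ)
      (μ.prod volume) :=
    integrable_mul_of_hasCompactSupport
      (integrableOn_comp_fst (integrable_normalAverage hv hδ') W δ)
      hH1.continuous hHc
  have hHz : ∀ p ∉ W ×ˢ Ioo 0 δ, H p = 0 := fun p hp =>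
    image_eq_zero_of_notMem_tsupport fun h => hp (hHs h)
  have iTH' : Integrable (fun p : X × ℝ => normalAverage v δ' p.1 * H p) (μ.prod volume) :=
    (integrableOn_iff_integrable_of_support_subset fun p hp => by
      by_contra h
      exact hp (by simp [hHz p h])).1 iTH
  have e1 : ∫ p in W ×ˢ Ioo 0 δ, (v p - normalAverage v δ' p.1) * H p ∂(μ.prod volume)
      = ∫ p, v p * H p ∂(μ.prod volume)
        - ∫ p, normalAverage v δ' p.1 * H p ∂(μ.prod volume) := by
    rw [setIntegral_eq_integral_of_forall_compl_eq_zero fun p hp => by rw [hHz p hp, mul_zero],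
      ← integral_sub iH iTH']
    simp only [sub_mul]
  have e2 : ∫ p, v p * (H p - deriv P p.2 * G (p.1, δ)) ∂(μ.prod volume)
      = ∫ p, v p * H p ∂(μ.prod volume)
        - ∫ p, (v p * deriv P p.2) * G (p.1, δ) ∂(μ.prod volume) := by
    rw [← integral_sub iH iG]
    simp only [mul_sub, mul_assoc]
  have e3 : ∫ p, normalAverage v δ' p.1 * H p ∂(μ.prod volume)
      = ∫ p, (v p * deriv P p.2) * G (p.1, δ) ∂(μ.prod volume) := by
    rw [integral_prod _ iTH', integral_prod _ iG]
    refine integral_congr_ae (Eventually.of_forall fun x => ?_)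
    simp only
    rw [integral_const_mul, integral_mul_const, hGint]
    rfl
  change ∫ p in W ×ˢ Ioo 0 δ, (v p - normalAverage v δ' p.1) * H p ∂(μ.prod volume) = _
  rw [e1, e2, e3]

end Slab

/-! ### Coordinates on the half-space -/

section Coordinates

variable {n : ℕ}

/-- The coordinates `(x, t) ↦ (x, t)` identifying `ℝⁿ × ℝ` with `ℝⁿ⁺¹`. -/
noncomputable def prodEquiv (n : ℕ) :
    (EuclideanSpace ℝ (Fin n) × ℝ) ≃L[ℝ] EuclideanSpace ℝ (Fin (n + 1)) :=
  LinearEquiv.toContinuousLinearEquiv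
    { toFun := fun p => WithLp.toLp 2 (Fin.snoc (α := fun _ => ℝ) (fun i => p.1 i) p.2)
      invFun := fun x => (WithLp.toLp 2 fun i => x i.castSucc, x (Fin.last n))
      map_add' := fun p q => by
        ext i
        refine Fin.lastCases ?_ (fun j => ?_) i <;> simp
      map_smul' := fun c p => by
        ext i
        refine Fin.lastCases ?_ (fun j => ?_) i <;> simp
      left_inv := fun p => by
        ext i <;> simp
      right_inv := fun x => by
        ext i
        refine Fin.lastCases ?_ (fun j => ?_) i <;> simp }

theorem prodEquiv_apply (p : EuclideanSpace ℝ (Fin n) × ℝ) :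
    prodEquiv n p = WithLp.toLp 2 (Fin.snoc (α := fun _ => ℝ) (fun i => p.1 i) p.2) := rfl

@[simp] theorem prodEquiv_last (p : EuclideanSpace ℝ (Fin n) × ℝ) :
    prodEquiv n p (Fin.last n) = p.2 := by
  simp [prodEquiv_apply]

@[simp] theorem prodEquiv_castSucc (p : EuclideanSpace ℝ (Fin n) × ℝ) (i : Fin n) :
    prodEquiv n p i.castSucc = p.1 i := by
  simp [prodEquiv_apply]

theorem toBoundary_eq (x : EuclideanSpace ℝ (Fin n)) : toBoundary x = prodEquiv n (x, 0) := rfl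

theorem prodEquiv_zero_one :
    prodEquiv n (0, 1) = EuclideanSpace.single (Fin.last n) (1 : ℝ) := by
  ext i
  refine Fin.lastCases ?_ (fun j => ?_) i
  · simp
  · rw [prodEquiv_castSucc]
    simp [(Fin.castSucc_lt_last j).ne]

theorem norm_prodEquiv_sq (p : EuclideanSpace ℝ (Fin n) × ℝ) :
    ‖prodEquiv n p‖ ^ 2 = ‖p.1‖ ^ 2 + p.2 ^ 2 := by
  simp [EuclideanSpace.norm_sq_eq, Fin.sum_univ_castSucc]

theorem measurePreserving_prodEquiv :
    MeasurePreserving (prodEquiv n) (volume.prod volume) volume := by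
  have h1 : MeasurePreserving (fun p : EuclideanSpace ℝ (Fin n) × ℝ =>
      ((WithLp.ofLp p.1 : Fin n → ℝ), p.2)) (volume.prod volume) (volume.prod volume) :=
    (PiLp.volume_preserving_ofLp (Fin n)).prod (MeasurePreserving.id _)
  have h2 : MeasurePreserving (Prod.swap : (Fin n → ℝ) × ℝ → ℝ × (Fin n → ℝ))
    (volume.prod volume) (volume.prod volume) := Measure.measurePreserving_swap
  have h3 := (volume_preserving_piFinSuccAbove (fun _ : Fin (n + 1) => ℝ) (Fin.last n)).symm
  have h4 := PiLp.volume_preserving_toLp (Fin (n + 1))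
  have h := h4.comp (h3.comp (h2.comp h1))
  refine (congrArg (fun f => MeasurePreserving f (volume.prod volume) volume) ?_).mpr h
  funext p
  rw [prodEquiv_apply]
  simp only [Function.comp]
  congr 1
  funext i
  simp [MeasurableEquiv.piFinSuccAbove, Fin.insertNthEquiv, Fin.insertNth_last']

theorem measurableEmbedding_prodEquiv : MeasurableEmbedding (prodEquiv n) :=
  (prodEquiv n).toHomeomorph.measurableEmbedding

theorem integral_comp_prodEquiv (f : EuclideanSpace ℝ (Fin (n + 1)) → ℝ) :
    ∫ p, f (prodEquiv n p) ∂(volume.prod volume) = ∫ x, f x :=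
  measurePreserving_prodEquiv.integral_comp measurableEmbedding_prodEquiv f

theorem isOpen_halfSpace : IsOpen (halfSpace n) :=
  isOpen_lt continuous_const (by fun_prop)

/-- The cylinder `W × (0, δ)` over a subset `W` of the boundary. -/
def cylinder (W : Set (EuclideanSpace ℝ (Fin n))) (δ : ℝ) :
    Set (EuclideanSpace ℝ (Fin (n + 1))) :=
  (prodEquiv n).symm ⁻¹' (W ×ˢ Ioo 0 δ)

theorem cylinder_subset_halfSpace (W : Set (EuclideanSpace ℝ (Fin n))) (δ : ℝ) :
    cylinder W δ ⊆ halfSpace n := fun _ hx => hx.2.1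

theorem cylinder_mono {W W' : Set (EuclideanSpace ℝ (Fin n))} (h : W ⊆ W') {δ δ' : ℝ}
    (hδ : δ ≤ δ') : cylinder W δ ⊆ cylinder W' δ' :=
  preimage_mono (prod_mono h (Ioo_subset_Ioo_right hδ))

/-! ### Normal test fields -/

/-- The vector field `Ψ e`, where `e` is the unit vector normal to the boundary. -/
noncomputable def normalField (Ψ : EuclideanSpace ℝ (Fin n) × ℝ → ℝ)
    (x : EuclideanSpace ℝ (Fin (n + 1))) : EuclideanSpace ℝ (Fin (n + 1)) :=
  Ψ ((prodEquiv n).symm x) • prodEquiv n (0, 1)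

theorem divergence_normalField {Ψ : EuclideanSpace ℝ (Fin n) × ℝ → ℝ} (hΨ : ContDiff ℝ 1 Ψ)
    (p : EuclideanSpace ℝ (Fin n) × ℝ) :
    divergence (normalField Ψ) (prodEquiv n p) = fderiv ℝ Ψ p (0, 1) := by
  have h : ContDiff ℝ 1 fun x => Ψ ((prodEquiv n).symm x) := hΨ.comp (prodEquiv n).symm.contDiff
  unfold normalField
  rw [divergence_smul_const h]
  have := (prodEquiv n).symm.comp_right_fderiv (f := Ψ) (x := prodEquiv n p)
  change fderiv ℝ (Ψ ∘ (prodEquiv n).symm) _ _ = _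
  rw [this]
  simp

theorem integral_divergence_normalField (w : EuclideanSpace ℝ (Fin (n + 1)) → ℝ)
    {Ψ : EuclideanSpace ℝ (Fin n) × ℝ → ℝ} (hΨ : ContDiff ℝ 1 Ψ) :
    ∫ x, w x * divergence (normalField Ψ) x
      = ∫ p, w (prodEquiv n p) * fderiv ℝ Ψ p (0, 1) ∂(volume.prod volume) := by
  rw [← integral_comp_prodEquiv]
  simp only [divergence_normalField hΨ]

theorem isTestField_normalField {Ψ : EuclideanSpace ℝ (Fin n) × ℝ → ℝ} (hΨ : ContDiff ℝ 1 Ψ)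
    (hc : HasCompactSupport Ψ) {S : Set (EuclideanSpace ℝ (Fin n) × ℝ)} (hS : tsupport Ψ ⊆ S)
    (hb : ∀ p, |Ψ p| ≤ 1) : IsTestField ((prodEquiv n).symm ⁻¹' S) (normalField Ψ) := by
  have h1 : tsupport (normalField Ψ) ⊆ (prodEquiv n).symm ⁻¹' tsupport Ψ := by
    refine closure_minimal (fun x hx => subset_tsupport _ fun h0 => hx ?_)
      ((isClosed_tsupport Ψ).preimage (prodEquiv n).symm.continuous)
    simp [normalField, h0]
  refine ⟨(hΨ.comp (prodEquiv n).symm.contDiff).smul contDiff_const, ?_,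
    h1.trans (preimage_mono hS), fun x => ?_⟩
  · exact ((prodEquiv n).symm.toHomeomorph.isCompact_preimage.2 hc).of_isClosed_subset
      (isClosed_tsupport _) h1
  · simpa [normalField, norm_smul, prodEquiv_zero_one] using hb _

theorem exists_pos_le_of_isCompact {K : Set (EuclideanSpace ℝ (Fin (n + 1)))} (hK : IsCompact K)
    (hKs : K ⊆ halfSpace n) : ∃ a > 0, ∀ x ∈ K, a ≤ x (Fin.last n) := by
  rcases K.eq_empty_or_nonempty with he | hne
  · exact ⟨1, one_pos, by simp [he]⟩
  · obtain ⟨x, hx, hmin⟩ := hK.exists_isMinOn hne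
      (f := fun x : EuclideanSpace ℝ (Fin (n + 1)) => x (Fin.last n)) (by fun_prop)
    exact ⟨x (Fin.last n), hKs hx, fun y hy => hmin hy⟩

end Coordinates

/-! ### Construction of the boundary trace -/

theorem exists_integrable_limit_of_cauchy {X : Type*} [MeasurableSpace X] {μ : Measure X}
    {f : ℕ → X → ℝ} (hf : ∀ k, Integrable (f k) μ)
    (hc : ∀ ε > 0, ∃ N, ∀ i ≥ N, ∀ j ≥ N, ∫ x, |f i x - f j x| ∂μ ≤ ε) :
    ∃ T : X → ℝ, Integrable T μ ∧ Tendsto (fun k => ∫ x, |f k x - T x| ∂μ) atTop (𝓝 0) := by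
  have hdist : ∀ {a b : X → ℝ} (ha : Integrable a μ) (hb : Integrable b μ),
      dist (ha.toL1 a) (hb.toL1 b) = ∫ x, |a x - b x| ∂μ := by
    intro a b ha hb
    rw [dist_edist, Integrable.edist_toL1_toL1]
    simp only [edist_dist, Real.dist_eq]
    rw [integral_eq_lintegral_of_nonneg_ae (f := fun x => |a x - b x|)
      (Eventually.of_forall fun x => abs_nonneg _)
      (by exact (ha.sub hb).abs.aestronglyMeasurable)]
  have hcs : CauchySeq fun k => (hf k).toL1 (f k) := by
    rw [Metric.cauchySeq_iff]
    intro ε hε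
    obtain ⟨N, hN⟩ := hc (ε / 2) (half_pos hε)
    refine ⟨N, fun i hi j hj => ?_⟩
    rw [hdist]
    linarith [hN i hi j hj]
  obtain ⟨T, hT⟩ := cauchySeq_tendsto_of_complete hcs
  refine ⟨T, L1.integrable_coeFn T, ?_⟩
  rw [tendsto_iff_dist_tendsto_zero] at hT
  have : T = (L1.integrable_coeFn T).toL1 T := (Integrable.toL1_coeFn T _).symm
  refine hT.congr fun k => ?_
  conv_lhs => rw [this]
  exact hdist _ _

section Trace

variable {n : ℕ} {w : EuclideanSpace ℝ (Fin (n + 1)) → ℝ}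

theorem integrable_comp_prodEquiv (hw : Integrable w) :
    Integrable (fun p => w (prodEquiv n p)) (volume.prod volume) :=
  measurePreserving_prodEquiv.integrable_comp_of_integrable hw

/-- The total variation carries no mass at the boundary of the half-space: a nearly optimal test
field has compact support, hence vanishes in a boundary layer. -/
theorem tendsto_variation_boundaryLayer (hw : Integrable w)
    (hfin : variation w (halfSpace n) ≠ ∞) :
    Tendsto (fun δ => (variation w (cylinder (univ : Set (EuclideanSpace ℝ (Fin n))) δ)).toReal)
      (𝓝[>] 0) (𝓝 0) := by
  rw [Metric.tendsto_nhds]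
  intro ε hε
  obtain ⟨g, hg, hgV⟩ := exists_isTestField_lt hfin hε
  obtain ⟨a, ha, haK⟩ := exists_pos_le_of_isCompact hg.2.1 hg.2.2.1
  filter_upwards [Ioo_mem_nhdsGT ha] with δ hδ
  set V : Set (EuclideanSpace ℝ (Fin (n + 1))) := {x | δ < x (Fin.last n)} with hV
  have hgV' : IsTestField V g := ⟨hg.1, hg.2.1, fun x hx => hδ.2.trans_le (haK x hx), hg.2.2.2⟩
  have hsub : cylinder (univ : Set (EuclideanSpace ℝ (Fin n))) δ ∪ V ⊆ halfSpace n :=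
    union_subset (cylinder_subset_halfSpace _ _) fun x hx => hδ.1.trans hx
  have hd : Disjoint (cylinder (univ : Set (EuclideanSpace ℝ (Fin n))) δ) V := by
    rw [disjoint_left]
    intro x hx hx'
    exact lt_asymm (show x (Fin.last n) < δ from hx.2.2) hx'
  have h1 := variation_add_le hw hd (ne_top_of_le_ne_top hfin (variation_mono w hsub))
  have h2 := ENNReal.toReal_mono hfin (variation_mono w hsub)
  have h3 := hgV'.integral_le (w := w) (ne_top_of_le_ne_top hfin
    (variation_mono w (subset_union_right.trans hsub)))
  rw [Real.dist_eq, sub_zero, abs_of_nonneg ENNReal.toReal_nonneg]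
  linarith

theorem setIntegral_abs_sub_normalAverage_le_variation (hw : Integrable w)
    (hfin : variation w (halfSpace n) ≠ ∞) {W : Set (EuclideanSpace ℝ (Fin n))} (hW : IsOpen W)
    {δ δ' : ℝ} (hδ' : 0 < δ') (hδ : δ' ≤ δ) :
    ∫ p in W ×ˢ Ioo 0 δ, |w (prodEquiv n p) - normalAverage (fun p => w (prodEquiv n p)) δ' p.1|
      ∂(volume.prod volume) ≤ δ * (variation w (cylinder W δ)).toReal := by
  refine setIntegral_abs_sub_normalAverage_le (integrable_comp_prodEquiv hw) hW hδ' hδ ?_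
  intro Ψ h1 h2 h3 h4
  rw [← integral_divergence_normalField w h1]
  exact (isTestField_normalField h1 h2 h3 h4).integral_le
    (ne_top_of_le_ne_top hfin (variation_mono w (cylinder_subset_halfSpace W δ)))

/-- The normal averages of `w` converge in `L¹(∂Ω)` as the layer shrinks, and `w` is close to the
limit on every cylinder `W × (0, δ)`, with an error controlled by the variation of `w` there. -/
theorem exists_boundary_limit (hw : Integrable w) (hfin : variation w (halfSpace n) ≠ ∞) :
    ∃ T : EuclideanSpace ℝ (Fin n) → ℝ, Integrable T ∧
      ∀ W : Set (EuclideanSpace ℝ (Fin n)), IsOpen W → ∀ δ : ℝ, 0 < δ →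
        ∫ p in W ×ˢ Ioo 0 δ, |w (prodEquiv n p) - T p.1| ∂(volume.prod volume)
          ≤ δ * (variation w (cylinder W δ)).toReal := by
  set v : EuclideanSpace ℝ (Fin n) × ℝ → ℝ := fun p => w (prodEquiv n p) with hv
  have hvi : Integrable v (volume.prod volume) := integrable_comp_prodEquiv hw
  set d : ℕ → ℝ := fun k => 1 / ((k : ℝ) + 1) with hd
  have hd0 : ∀ k, 0 < d k := fun k => by positivity
  have hdlim : Tendsto d atTop (𝓝 0) := tendsto_one_div_add_atTop_nhds_zero_nat
  have hTi : ∀ k, Integrable (normalAverage v (d k)) := fun k =>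
    integrable_normalAverage hvi (hd0 k)
  have hiv : ∀ {T : EuclideanSpace ℝ (Fin n) → ℝ}, Integrable T → ∀ W δ,
      IntegrableOn (fun p => |v p - T p.1|) (W ×ˢ Ioo 0 δ) (volume.prod volume) :=
    fun hT W δ => (hvi.integrableOn.sub (integrableOn_comp_fst hT W δ)).abs
  have hiT : ∀ {T T' : EuclideanSpace ℝ (Fin n) → ℝ}, Integrable T → Integrable T' → ∀ W δ,
      IntegrableOn (fun p : EuclideanSpace ℝ (Fin n) × ℝ => |T p.1 - T' p.1|) (W ×ˢ Ioo 0 δ)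
        (volume.prod volume) :=
    fun hT hT' W δ => integrableOn_comp_fst (T := fun x => |_ - _|) (hT.sub hT').abs W δ
  obtain ⟨T, hT, hlim⟩ := exists_integrable_limit_of_cauchy hTi (by
    intro ε hε
    obtain ⟨δ, hδε, hδ0⟩ : ∃ δ, (variation w (cylinder (univ : Set (EuclideanSpace ℝ (Fin n)))
        δ)).toReal < ε / 2 ∧ 0 < δ :=
      (((tendsto_variation_boundaryLayer hw hfin).eventually_lt_const (half_pos hε)).and
        self_mem_nhdsWithin).exists
    obtain ⟨N, hN⟩ := eventually_atTop.1 (hdlim.eventually_lt_const hδ0)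
    refine ⟨N, fun i hi j hj => ?_⟩
    have h1 := setIntegral_abs_sub_normalAverage_le_variation hw hfin isOpen_univ (hd0 i)
      (hN i hi).le
    have h2 := setIntegral_abs_sub_normalAverage_le_variation hw hfin isOpen_univ (hd0 j)
      (hN j hj).le
    have h3 := setIntegral_comp_fst (μ := (volume : Measure (EuclideanSpace ℝ (Fin n))))
      (T := fun x => |normalAverage v (d i) x - normalAverage v (d j) x|) univ hδ0.le
    rw [setIntegral_univ] at h3
    have h4 : ∫ p in univ ×ˢ Ioo 0 δ, |normalAverage v (d i) p.1 - normalAverage v (d j) p.1|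
        ∂(volume.prod volume) ≤ ∫ p in univ ×ˢ Ioo 0 δ, (|v p - normalAverage v (d i) p.1|
          + |v p - normalAverage v (d j) p.1|) ∂(volume.prod volume) :=
      integral_mono (hiT (hTi i) (hTi j) _ _) ((hiv (hTi i) _ _).add (hiv (hTi j) _ _)) fun p => by
        have := abs_sub_le (normalAverage v (d i) p.1) (v p) (normalAverage v (d j) p.1)
        rwa [abs_sub_comm _ (v p)] at this
    rw [integral_add (hiv (hTi i) _ _) (hiv (hTi j) _ _)] at h4
    have h5 : δ * ∫ x, |normalAverage v (d i) x - normalAverage v (d j) x| ≤ δ * ε := by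
      have := mul_le_mul_of_nonneg_left hδε.le hδ0.le
      linarith
    exact le_of_mul_le_mul_left h5 hδ0)
  refine ⟨T, hT, fun W hW δ hδ => ?_⟩
  have hlim' : Tendsto (fun k => δ * (variation w (cylinder W δ)).toReal
      + δ * ∫ x, |normalAverage v (d k) x - T x|) atTop
      (𝓝 (δ * (variation w (cylinder W δ)).toReal + δ * 0)) :=
    tendsto_const_nhds.add (hlim.const_mul δ)
  rw [mul_zero, add_zero] at hlim'
  refine ge_of_tendsto hlim' ?_
  filter_upwards [hdlim.eventually_lt_const hδ] with k hk
  have h1 := setIntegral_abs_sub_normalAverage_le_variation hw hfin hW (hd0 k) hk.le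
  have h3 := setIntegral_comp_fst (μ := (volume : Measure (EuclideanSpace ℝ (Fin n))))
    (T := fun x => |normalAverage v (d k) x - T x|) W hδ.le
  have h4 : ∫ p in W ×ˢ Ioo 0 δ, |v p - T p.1| ∂(volume.prod volume)
      ≤ ∫ p in W ×ˢ Ioo 0 δ, (|v p - normalAverage v (d k) p.1|
        + |normalAverage v (d k) p.1 - T p.1|) ∂(volume.prod volume) :=
    integral_mono (hiv hT _ _) ((hiv (hTi k) _ _).add (hiT (hTi k) hT _ _)) fun p =>
      abs_sub_le _ _ _
  rw [integral_add (hiv (hTi k) _ _) (hiT (hTi k) hT _ _), h3] at h4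
  have h5 : ∫ x in W, |normalAverage v (d k) x - T x| ≤ ∫ x, |normalAverage v (d k) x - T x| :=
    setIntegral_le_integral ((hTi k).sub hT).abs (Eventually.of_forall fun x => abs_nonneg _)
  have h6 := mul_le_mul_of_nonneg_left h5 hδ.le
  linarith

end Trace

/-! ### Existence of the trace -/

section TraceExists

variable {n : ℕ} {w : EuclideanSpace ℝ (Fin (n + 1)) → ℝ}

/-- Almost every boundary point has vanishing `n`-dimensional density for the total variation in
the half-space. By the Besicovitch covering theorem, the set where the density exceeds `c` has
measure at most `1 / c` times the variation in an arbitrarily thin boundary layer. -/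
theorem ae_tendsto_variation_cylinder_div (hw : Integrable w)
    (hfin : variation w (halfSpace n) ≠ ∞) :
    ∀ᵐ x : EuclideanSpace ℝ (Fin n), Tendsto (fun r =>
      (variation w (cylinder (Metric.ball x r) r)).toReal / volume.real (Metric.closedBall x r))
      (𝓝[>] 0) (𝓝 0) := by
  have hnull : ∀ c : ℝ, 0 < c → volume {x : EuclideanSpace ℝ (Fin n) | ∃ᶠ r in 𝓝[>] (0 : ℝ),
      c * volume.real (Metric.closedBall x r)
        < (variation w (cylinder (Metric.ball x r) r)).toReal} = 0 := by
    intro c hc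
    set S := {x : EuclideanSpace ℝ (Fin n) | ∃ᶠ r in 𝓝[>] (0 : ℝ),
      c * volume.real (Metric.closedBall x r)
        < (variation w (cylinder (Metric.ball x r) r)).toReal} with hS
    have hbound : ∀ δ > 0, volume S ≤ ENNReal.ofReal
        ((variation w (cylinder (univ : Set (EuclideanSpace ℝ (Fin n))) δ)).toReal / c) := by
      intro δ hδ
      obtain ⟨t, r, htc, htS, htr, hcov, hdis⟩ := Besicovitch.exists_disjoint_closedBall_covering_ae
        (volume : Measure (EuclideanSpace ℝ (Fin n)))
        (fun x => {r | c * volume.real (Metric.closedBall x r)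
          < (variation w (cylinder (Metric.ball x r) r)).toReal}) S
        (fun x hx η hη => by
          obtain ⟨r, h1, h2⟩ := (Frequently.and_eventually hx (Ioo_mem_nhdsGT hη)).exists
          exact ⟨r, h1, h2⟩) (fun _ => δ) (fun _ _ => hδ)
      have h1 : volume S ≤ volume (⋃ x ∈ t, Metric.closedBall x (r x)) := by
        refine (measure_le_inter_add_sdiff volume S (⋃ x ∈ t, Metric.closedBall x (r x))).trans ?_
        rw [hcov, add_zero]
        exact measure_mono inter_subset_right
      refine h1.trans ((measure_biUnion_le volume htc _).trans ?_)
      rw [ENNReal.tsum_eq_iSup_sum]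
      refine iSup_le fun s => ?_
      have h2 := sum_variation_le s (U := fun x : t => cylinder (Metric.ball (x : _) (r x)) (r x))
        (V := cylinder (univ : Set (EuclideanSpace ℝ (Fin n))) δ) hw
        (ne_top_of_le_ne_top hfin (variation_mono w (cylinder_subset_halfSpace _ _)))
        (fun x _ => cylinder_mono (subset_univ _) (htr x x.2).2.2.le) (by
          intro x _ y _ hxy
          refine Disjoint.preimage _ (disjoint_prod.2 (Or.inl ?_))
          exact (hdis x.2 y.2 fun h => hxy (Subtype.ext h)).mono Metric.ball_subset_closedBall
            Metric.ball_subset_closedBall)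
      have h3 : ∑ x ∈ s, volume.real (Metric.closedBall (x : EuclideanSpace ℝ (Fin n)) (r x))
          ≤ (variation w (cylinder (univ : Set (EuclideanSpace ℝ (Fin n))) δ)).toReal / c := by
        rw [le_div_iff₀ hc, Finset.sum_mul]
        refine le_trans (Finset.sum_le_sum fun x _ => ?_) h2
        have := (htr x x.2).1
        rw [mul_comm]
        exact this.le
      refine le_trans (le_of_eq ?_) (ENNReal.ofReal_le_ofReal h3)
      rw [ENNReal.ofReal_sum_of_nonneg fun _ _ => measureReal_nonneg]
      exact Finset.sum_congr rfl fun x _ =>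
        (ofReal_measureReal measure_closedBall_lt_top.ne).symm
    have hlim : Tendsto (fun δ => ENNReal.ofReal
        ((variation w (cylinder (univ : Set (EuclideanSpace ℝ (Fin n))) δ)).toReal / c))
        (𝓝[>] 0) (𝓝 0) := by
      have := ENNReal.tendsto_ofReal ((tendsto_variation_boundaryLayer hw hfin).div_const c)
      simpa using this
    refine le_antisymm (ge_of_tendsto hlim ?_) (zero_le)
    filter_upwards [self_mem_nhdsWithin] with δ hδ using hbound δ hδ
  have hall : ∀ᵐ x : EuclideanSpace ℝ (Fin n), ∀ k : ℕ, ∀ᶠ r in 𝓝[>] (0 : ℝ),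
      (variation w (cylinder (Metric.ball x r) r)).toReal
        ≤ 1 / ((k : ℝ) + 1) * volume.real (Metric.closedBall x r) := by
    rw [ae_all_iff]
    intro k
    rw [ae_iff]
    simpa only [not_eventually, not_le] using hnull (1 / ((k : ℝ) + 1)) (by positivity)
  filter_upwards [hall] with x hx
  rw [Metric.tendsto_nhds]
  intro ε hε
  obtain ⟨k, hk⟩ := exists_nat_one_div_lt hε
  filter_upwards [hx k, self_mem_nhdsWithin] with r hr hr0
  have hpos : 0 < volume.real (Metric.closedBall x r) :=
    ENNReal.toReal_pos (Metric.measure_closedBall_pos volume x hr0).ne'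
      measure_closedBall_lt_top.ne
  rw [Real.dist_eq, sub_zero, abs_of_nonneg (by positivity), div_lt_iff₀ hpos]
  exact hr.trans_lt (mul_lt_mul_of_pos_right hk hpos)

theorem volume_cylinder (W : Set (EuclideanSpace ℝ (Fin n))) {δ : ℝ} (hδ : 0 ≤ δ) :
    volume.real (cylinder W δ) = δ * volume.real W := by
  have h : (prodEquiv n) ⁻¹' cylinder W δ = W ×ˢ Ioo 0 δ := by
    ext p
    simp [cylinder]
  have := measurePreserving_prodEquiv.measure_preimage_emb measurableEmbedding_prodEquiv
    (cylinder W δ)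
  rw [measureReal_def, ← this, h, Measure.prod_prod, ENNReal.toReal_mul, Real.volume_Ioo,
    sub_zero, ENNReal.toReal_ofReal hδ, mul_comm]
  rfl

theorem setIntegral_cylinder (f : EuclideanSpace ℝ (Fin (n + 1)) → ℝ)
    (W : Set (EuclideanSpace ℝ (Fin n))) (δ : ℝ) :
    ∫ x in cylinder W δ, f x
      = ∫ p in W ×ˢ Ioo 0 δ, f (prodEquiv n p) ∂(volume.prod volume) := by
  rw [← measurePreserving_prodEquiv.setIntegral_preimage_emb measurableEmbedding_prodEquiv]
  congr 2
  ext p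
  simp [cylinder]

theorem halfBall_subset_cylinder (x : EuclideanSpace ℝ (Fin n)) (r : ℝ) :
    Metric.ball (toBoundary x) r ∩ halfSpace n ⊆ cylinder (Metric.ball x r) r := by
  rintro z ⟨hz, hz0⟩
  obtain ⟨⟨y, t⟩, rfl⟩ := (prodEquiv n).surjective z
  have hr : 0 < r := Metric.pos_of_mem_ball hz
  have ht : 0 < t := by simpa [halfSpace] using hz0
  rw [Metric.mem_ball, dist_eq_norm, toBoundary_eq, ← map_sub] at hz
  have h := norm_prodEquiv_sq ((y, t) - (x, 0) : EuclideanSpace ℝ (Fin n) × ℝ)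
  simp only [Prod.fst_sub, Prod.snd_sub, sub_zero] at h
  have h2 : ‖y - x‖ ^ 2 + t ^ 2 < r ^ 2 := by
    rw [← h]
    exact pow_lt_pow_left₀ hz (norm_nonneg _) two_ne_zero
  simp only [cylinder, mem_preimage, ContinuousLinearEquiv.symm_apply_apply, mem_prod,
    Metric.mem_ball, mem_Ioo, dist_eq_norm]
  refine ⟨lt_of_pow_lt_pow_left₀ 2 hr.le (by nlinarith), ht,
    lt_of_pow_lt_pow_left₀ 2 hr.le (by nlinarith [norm_nonneg (y - x)])⟩

theorem cylinder_half_subset_halfBall (x : EuclideanSpace ℝ (Fin n)) {r : ℝ} (hr : 0 < r) :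
    cylinder (Metric.ball x (r / 2)) (r / 2) ⊆ Metric.ball (toBoundary x) r ∩ halfSpace n := by
  intro z hz
  refine ⟨?_, cylinder_subset_halfSpace _ _ hz⟩
  obtain ⟨⟨y, t⟩, rfl⟩ := (prodEquiv n).surjective z
  simp only [cylinder, mem_preimage, ContinuousLinearEquiv.symm_apply_apply, mem_prod,
    Metric.mem_ball, mem_Ioo, dist_eq_norm] at hz
  rw [Metric.mem_ball, dist_eq_norm, toBoundary_eq, ← map_sub]
  have h := norm_prodEquiv_sq ((y, t) - (x, 0) : EuclideanSpace ℝ (Fin n) × ℝ)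
  simp only [Prod.fst_sub, Prod.snd_sub, sub_zero] at h
  refine lt_of_pow_lt_pow_left₀ 2 hr.le ?_
  rw [Prod.mk_sub_mk, sub_zero] at *
  rw [h]
  nlinarith [norm_nonneg (y - x), hz.1, hz.2.1, hz.2.2]

theorem volume_ball_half (x : EuclideanSpace ℝ (Fin n)) {r : ℝ} (hr : 0 < r) :
    volume.real (Metric.ball x (r / 2)) = (1 / 2) ^ n * volume.real (Metric.closedBall x r) := by
  rw [measureReal_def, measureReal_def, Measure.addHaar_ball_of_pos _ _ (half_pos hr),
    Measure.addHaar_closedBall _ _ hr.le, ENNReal.toReal_mul, ENNReal.toReal_mul,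
    ENNReal.toReal_ofReal (by positivity), ENNReal.toReal_ofReal (by positivity),
    finrank_euclideanSpace_fin, div_eq_mul_one_div r, mul_pow]
  ring

theorem integrableOn_abs_sub_const (hw : Integrable w) {S : Set (EuclideanSpace ℝ (Fin (n + 1)))}
    (hS : volume S ≠ ∞) (c : ℝ) : IntegrableOn (fun z => |w z - c|) S :=
  (hw.integrableOn.sub (integrableOn_const hS)).abs

/-- At a Lebesgue point of `T` where the variation has vanishing density, the mean values of `w`
over half-balls converge to `T`. -/
theorem ae_tendsto_average_halfBall (hw : Integrable w) (hfin : variation w (halfSpace n) ≠ ∞)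
    {T : EuclideanSpace ℝ (Fin n) → ℝ} (hT : Integrable T)
    (hTw : ∀ W : Set (EuclideanSpace ℝ (Fin n)), IsOpen W → ∀ δ : ℝ, 0 < δ →
      ∫ p in W ×ˢ Ioo 0 δ, |w (prodEquiv n p) - T p.1| ∂(volume.prod volume)
        ≤ δ * (variation w (cylinder W δ)).toReal) :
    ∀ᵐ x : EuclideanSpace ℝ (Fin n), Tendsto
      (fun r : ℝ => ⨍ z in Metric.ball (toBoundary x) r ∩ halfSpace n, w z)
      (𝓝[>] (0 : ℝ)) (𝓝 (T x)) := by
  filter_upwards [ae_tendsto_variation_cylinder_div hw hfin,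
    IsUnifLocDoublingMeasure.ae_tendsto_average_norm_sub volume hT.locallyIntegrable 0]
    with x hx1 hx2
  have hx3 : Tendsto (fun r => ⨍ y in Metric.closedBall x r, |T y - T x|) (𝓝[>] 0) (𝓝 0) := by
    refine hx2 (fun _ => x) (fun r => r) tendsto_id ?_
    simp
  have hlim := (hx1.add hx3).const_mul ((2 : ℝ) ^ (n + 1))
  rw [add_zero, mul_zero] at hlim
  rw [tendsto_iff_dist_tendsto_zero]
  refine squeeze_zero' (Eventually.of_forall fun r => dist_nonneg) ?_ hlim
  filter_upwards [self_mem_nhdsWithin] with r (hr : 0 < r)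
  set A := Metric.ball (toBoundary x) r ∩ halfSpace n with hA
  set B := volume.real (Metric.closedBall x r) with hB
  have hBpos : 0 < B :=
    ENNReal.toReal_pos (Metric.measure_closedBall_pos volume x hr).ne'
      measure_closedBall_lt_top.ne
  have hAfin : volume A ≠ ∞ :=
    ne_top_of_le_ne_top measure_ball_lt_top.ne (measure_mono inter_subset_left)
  have hCsub : cylinder (Metric.ball x r) r ⊆ Metric.ball (toBoundary x) (2 * r) := by
    have := cylinder_half_subset_halfBall x (r := 2 * r) (by positivity)
    rw [mul_div_cancel_left₀ r two_ne_zero] at this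
    exact this.trans inter_subset_left
  have hCfin : volume (cylinder (Metric.ball x r) r) ≠ ∞ :=
    ne_top_of_le_ne_top measure_ball_lt_top.ne (measure_mono hCsub)
  have hAlow : (1 / 2) ^ (n + 1) * (r * B) ≤ volume.real A := by
    refine le_trans (le_of_eq ?_)
      (measureReal_mono (cylinder_half_subset_halfBall x hr) hAfin)
    rw [volume_cylinder _ (by positivity), volume_ball_half x hr]
    ring
  have hApos : 0 < volume.real A := lt_of_lt_of_le (by positivity) hAlow
  have e1 : (⨍ z in A, w z) - T x = (volume.real A)⁻¹ * ∫ z in A, (w z - T x) := by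
    rw [setAverage_eq, integral_sub hw.integrableOn (integrableOn_const hAfin), setIntegral_const,
      smul_eq_mul, smul_eq_mul, mul_sub, inv_mul_cancel_left₀ hApos.ne']
  have e2 : |∫ z in A, (w z - T x)| ≤ ∫ z in cylinder (Metric.ball x r) r, |w z - T x| :=
    (abs_integral_le_integral_abs).trans (setIntegral_mono_set
      (integrableOn_abs_sub_const hw hCfin _) (Eventually.of_forall fun _ => abs_nonneg _)
      (halfBall_subset_cylinder x r).eventuallyLE)
  have hCi : IntegrableOn (fun p => |w (prodEquiv n p) - T x|) (Metric.ball x r ×ˢ Ioo 0 r)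
      (volume.prod volume) := by
    refine ((integrable_comp_prodEquiv hw).integrableOn.sub (integrableOn_const ?_)).abs
    rw [Measure.prod_prod]
    exact ENNReal.mul_ne_top measure_ball_lt_top.ne (by simp)
  have hi1 : IntegrableOn (fun p => |w (prodEquiv n p) - T p.1|) (Metric.ball x r ×ˢ Ioo 0 r)
      (volume.prod volume) :=
    ((integrable_comp_prodEquiv hw).integrableOn.sub (integrableOn_comp_fst hT _ _)).abs
  have hTball : IntegrableOn (fun y => |T y - T x|) (Metric.closedBall x r) :=
    (hT.integrableOn.sub (integrableOn_const measure_closedBall_lt_top.ne)).abs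
  have hi2 : IntegrableOn (fun p : EuclideanSpace ℝ (Fin n) × ℝ => |T p.1 - T x|)
      (Metric.ball x r ×ˢ Ioo 0 r) (volume.prod volume) := by
    rw [IntegrableOn, ← Measure.prod_restrict]
    exact Integrable.comp_fst (f := fun y => |T y - T x|)
      (hTball.mono_set Metric.ball_subset_closedBall) _
  have e3 : ∫ z in cylinder (Metric.ball x r) r, |w z - T x|
      ≤ r * (variation w (cylinder (Metric.ball x r) r)).toReal
        + r * ∫ y in Metric.closedBall x r, |T y - T x| := by
    rw [setIntegral_cylinder (fun z => |w z - T x|)]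
    have h4 : ∫ p in Metric.ball x r ×ˢ Ioo 0 r, |w (prodEquiv n p) - T x| ∂(volume.prod volume)
        ≤ ∫ p in Metric.ball x r ×ˢ Ioo 0 r, (|w (prodEquiv n p) - T p.1| + |T p.1 - T x|)
          ∂(volume.prod volume) :=
      integral_mono hCi (hi1.add hi2) fun p => abs_sub_le _ _ _
    rw [integral_add hi1 hi2, setIntegral_comp_fst (T := fun y => |T y - T x|) _ hr.le] at h4
    have h5 : ∫ y in Metric.ball x r, |T y - T x| ≤ ∫ y in Metric.closedBall x r, |T y - T x| :=
      setIntegral_mono_set hTball (Eventually.of_forall fun _ => abs_nonneg _)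
        Metric.ball_subset_closedBall.eventuallyLE
    have h6 := mul_le_mul_of_nonneg_left h5 hr.le
    linarith [hTw (Metric.ball x r) Metric.isOpen_ball r hr]
  rw [Real.dist_eq, e1, abs_mul, abs_of_pos (inv_pos.2 hApos), inv_mul_le_iff₀ hApos, setAverage_eq,
    smul_eq_mul]
  refine (e2.trans e3).trans ?_
  change _ ≤ volume.real A * (2 ^ (n + 1) * (_ / B + B⁻¹ * _))
  have hpow : (2 : ℝ) ^ (n + 1) * (1 / 2) ^ (n + 1) = 1 := by
    rw [← mul_pow]
    norm_num
  have hnn : 0 ≤ (variation w (cylinder (Metric.ball x r) r)).toReal / B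
      + B⁻¹ * ∫ y in Metric.closedBall x r, |T y - T x| := by
    have : 0 ≤ ∫ y in Metric.closedBall x r, |T y - T x| :=
      integral_nonneg fun _ => abs_nonneg _
    positivity
  refine le_trans (le_of_eq ?_) (mul_le_mul_of_nonneg_right hAlow (mul_nonneg (by positivity) hnn))
  have : ∀ a b : ℝ, r * a + r * b
      = (2 ^ (n + 1) * (1 / 2) ^ (n + 1)) * (r * B * (a / B + B⁻¹ * b)) := by
    intro a b
    rw [hpow]
    field_simp
  rw [this]
  ring

end TraceExists

/-! ### Variation across the boundary -/

theorem fderiv_mul_prod {X : Type*} [NormedAddCommGroup X] [NormedSpace ℝ X] {q : ℝ → ℝ}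
    (hq : ContDiff ℝ 1 q) {H : X → ℝ} (hH : ContDiff ℝ 1 H)
    (p : X × ℝ) : fderiv ℝ (fun p : X × ℝ => q p.2 * H p.1) p (0, 1) = deriv q p.2 * H p.1 := by
  obtain ⟨x, t⟩ := p
  refine fderiv_prod_apply_zero_one ((hq.comp contDiff_snd).mul (hH.comp contDiff_fst)) ?_
  exact ((hq.differentiable one_ne_zero t).hasDerivAt).mul_const (H x)

theorem tsupport_mul_prod_subset {X : Type*} [TopologicalSpace X] {q : ℝ → ℝ} {a b : ℝ}
    (hq : ∀ t ∉ Icc a b, q t = 0)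
    (H : X → ℝ) : tsupport (fun p : X × ℝ => q p.2 * H p.1) ⊆ tsupport H ×ˢ Icc a b := by
  refine closure_minimal (fun p hp => ?_) ((isClosed_tsupport H).prod isClosed_Icc)
  refine ⟨subset_tsupport _ fun h => hp (by simp [h]), ?_⟩
  by_contra h
  exact hp (by simp [hq _ h])

theorem hasCompactSupport_mul_prod {X : Type*} [TopologicalSpace X] {q : ℝ → ℝ} {a b : ℝ}
    (hq : ∀ t ∉ Icc a b, q t = 0) {H : X → ℝ} (hH : HasCompactSupport H) :
    HasCompactSupport (fun p : X × ℝ => q p.2 * H p.1) :=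
  (hH.isCompact.prod isCompact_Icc).of_isClosed_subset (isClosed_tsupport _)
    (tsupport_mul_prod_subset hq H)

theorem setIntegral_mul_deriv_scaledProfile {X : Type*} [MeasurableSpace X] {μ : Measure X}
    [SFinite μ] (F : X → ℝ) {δ : ℝ} (hδ : 0 < δ) :
    ∫ p in univ ×ˢ Ioo 0 δ, F p.1 * deriv (scaledProfile δ) p.2
      ∂(μ.prod (volume : Measure ℝ)) = ∫ x, F x ∂μ := by
  rw [← Measure.prod_restrict, integral_prod_mul, integral_deriv_scaledProfile hδ le_rfl,
    Measure.restrict_univ, mul_one]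

theorem setIntegral_eq_integral_mul_deriv_scaledProfile {X : Type*} [MeasurableSpace X]
    {μ : Measure X} (F : X × ℝ → ℝ) {δ : ℝ} (hδ : 0 < δ) :
    ∫ p in univ ×ˢ Ioo 0 δ, F p * deriv (scaledProfile δ) p.2 ∂(μ.prod (volume : Measure ℝ))
      = ∫ p, F p * deriv (scaledProfile δ) p.2 ∂(μ.prod (volume : Measure ℝ)) := by
  refine setIntegral_eq_integral_of_forall_compl_eq_zero fun p hp => ?_
  rw [deriv_scaledProfile_eq_zero hδ fun h => hp ⟨mem_univ _, by linarith [h.1], by linarith [h.2]⟩,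
    mul_zero]

section Gluing

variable {n : ℕ} {w : EuclideanSpace ℝ (Fin (n + 1)) → ℝ}
  {T : EuclideanSpace ℝ (Fin n) → ℝ} {C : ℝ}

/-- `T` is a boundary value of `w` in the `L¹` sense: on `∂Ω × (0, δ)` the distance of `w` to `T`
is at most `δ` times the variation of `w` there. -/
def IsBoundaryValue (w : EuclideanSpace ℝ (Fin (n + 1)) → ℝ)
    (T : EuclideanSpace ℝ (Fin n) → ℝ) : Prop :=
  ∀ δ : ℝ, 0 < δ → ∫ p in univ ×ˢ Ioo 0 δ, |w (prodEquiv n p) - T p.1| ∂(volume.prod volume)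
    ≤ δ * (variation w (cylinder univ δ)).toReal

theorem IsBoundaryValue.setIntegral_le (hTw : IsBoundaryValue w T) (hw : Integrable w)
    (hT : Integrable T) (hC : ∀ t, deriv profile t ≤ C) {δ : ℝ} (hδ : 0 < δ) :
    ∫ p in univ ×ˢ Ioo 0 δ, |w (prodEquiv n p) - T p.1| * deriv (scaledProfile δ) p.2
      ∂(volume.prod volume) ≤ C * (variation w (cylinder univ δ)).toReal := by
  have hi : IntegrableOn (fun p => |w (prodEquiv n p) - T p.1|) (univ ×ˢ Ioo 0 δ)
      (volume.prod volume) :=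
    ((integrable_comp_prodEquiv hw).integrableOn.sub (integrableOn_comp_fst hT _ _)).abs
  have h1 : ∫ p in univ ×ˢ Ioo 0 δ, |w (prodEquiv n p) - T p.1| * deriv (scaledProfile δ) p.2
      ∂(volume.prod volume)
      ≤ ∫ p in univ ×ˢ Ioo 0 δ, |w (prodEquiv n p) - T p.1| * (C / δ) ∂(volume.prod volume) := by
    refine integral_mono (integrable_mul_deriv_scaledProfile hi hδ) (hi.mul_const _) fun p => ?_
    refine mul_le_mul_of_nonneg_left ?_ (abs_nonneg _)
    rw [deriv_scaledProfile]
    exact div_le_div_of_nonneg_right (hC _) hδ.le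
  rw [integral_mul_const] at h1
  have hC0 : 0 ≤ C := (deriv_profile_nonneg 0).trans (hC 0)
  refine (h1.trans (mul_le_mul_of_nonneg_right (hTw δ hδ) (by positivity))).trans (le_of_eq ?_)
  field_simp

/-- Averaging `w` against the derivative of the profile approximates the boundary value. -/
theorem IsBoundaryValue.abs_integral_sub_le (hTw : IsBoundaryValue w T) (hw : Integrable w)
    (hT : Integrable T) (hC : ∀ t, deriv profile t ≤ C) {H : EuclideanSpace ℝ (Fin n) → ℝ}
    (hH : Continuous H) (hb : ∀ x, |H x| ≤ 1) {δ : ℝ} (hδ : 0 < δ) :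
    |∫ p, w (prodEquiv n p) * deriv (scaledProfile δ) p.2 * H p.1 ∂(volume.prod volume)
      - ∫ x, T x * H x| ≤ C * (variation w (cylinder univ δ)).toReal := by
  have hv := integrable_comp_prodEquiv hw
  have hHc : Continuous fun p : EuclideanSpace ℝ (Fin n) × ℝ => H p.1 := hH.comp continuous_fst
  have hvi := integrable_mul_deriv_scaledProfile (hv.restrict (s := univ ×ˢ Ioo 0 δ)) hδ
  have hTi := integrable_mul_deriv_scaledProfile (integrableOn_comp_fst hT univ δ) hδ
  have b : ∀ {F : EuclideanSpace ℝ (Fin n) × ℝ → ℝ} {ν : Measure (EuclideanSpace ℝ (Fin n) × ℝ)},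
      Integrable F ν → Integrable (fun p => F p * H p.1) ν := fun hF =>
    hF.mul_bdd (c := 1) hHc.aestronglyMeasurable (Eventually.of_forall fun p => hb p.1)
  have e1 : ∫ p, w (prodEquiv n p) * deriv (scaledProfile δ) p.2 * H p.1 ∂(volume.prod volume)
      = ∫ p in univ ×ˢ Ioo 0 δ, w (prodEquiv n p) * deriv (scaledProfile δ) p.2 * H p.1
        ∂(volume.prod volume) := by
    have := setIntegral_eq_integral_mul_deriv_scaledProfile (μ := volume)
      (fun p => w (prodEquiv n p) * H p.1) hδ
    simp only [mul_right_comm _ (H _)] at this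
    exact this.symm
  have e2 : ∫ x, T x * H x = ∫ p in univ ×ˢ Ioo 0 δ,
      T p.1 * deriv (scaledProfile δ) p.2 * H p.1 ∂(volume.prod volume) := by
    rw [← setIntegral_mul_deriv_scaledProfile (fun x => T x * H x) hδ]
    simp only [mul_right_comm _ (H _)]
  rw [e1, e2, ← integral_sub (b hvi) (b hTi)]
  refine abs_integral_le_integral_abs.trans (le_trans ?_ (hTw.setIntegral_le hw hT hC hδ))
  have hi : IntegrableOn (fun p => |w (prodEquiv n p) - T p.1|) (univ ×ˢ Ioo 0 δ)
      (volume.prod volume) :=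
    (hv.integrableOn.sub (integrableOn_comp_fst hT _ _)).abs
  refine integral_mono ((b hvi).sub (b hTi)).abs (integrable_mul_deriv_scaledProfile hi hδ)
    fun p => ?_
  simp only
  rw [← sub_mul, ← sub_mul, abs_mul, abs_mul, abs_of_nonneg (deriv_scaledProfile_nonneg hδ _)]
  exact mul_le_of_le_one_right
    (mul_nonneg (abs_nonneg _) (deriv_scaledProfile_nonneg hδ _)) (hb _)

/-- The trace inequality: in the half-space, the mass of the boundary value is at most the
variation. The test fields are `H(x) (P(t / δ) - P(t δ)) e` with `P` the profile: the first
term recovers `∫ T H` as `δ → 0`, and the contribution of the second is at most `C δ ∫ |w|`. -/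
theorem IsBoundaryValue.integral_abs_le (hTw : IsBoundaryValue w T) (hw : Integrable w)
    (hT : Integrable T) (hfin : variation w (halfSpace n) ≠ ∞) :
    ∫ x, |T x| ≤ (variation w (halfSpace n)).toReal := by
  obtain ⟨C, hC0, hC⟩ := exists_deriv_profile_le
  have hv := integrable_comp_prodEquiv hw
  rw [← setIntegral_univ]
  refine integral_abs_le_of_forall_contDiff isOpen_univ hT.integrableOn ?_
  intro H hH hHc _ hHb
  rw [setIntegral_univ]
  set I := ∫ p, |w (prodEquiv n p)| ∂(volume.prod volume) with hI
  have hbound : ∀ δ > 0, ∫ x, T x * H x ≤ (variation w (halfSpace n)).toReal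
      + (C * (variation w (cylinder (univ : Set (EuclideanSpace ℝ (Fin n))) δ)).toReal
        + C * δ * I) := by
    intro δ hδ
    have hR : 0 < δ⁻¹ := inv_pos.2 hδ
    set q : ℝ → ℝ := fun t => scaledProfile δ t - scaledProfile δ⁻¹ t with hq
    have hq1 : ContDiff ℝ 1 q := (contDiff_scaledProfile δ).sub (contDiff_scaledProfile δ⁻¹)
    have hq0 : ∀ t ∉ Icc (min δ δ⁻¹ / 4) (max δ δ⁻¹), q t = 0 := by
      intro t ht
      have m1 := min_le_left δ δ⁻¹
      have m2 := min_le_right δ δ⁻¹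
      have m3 := le_max_left δ δ⁻¹
      have m4 := le_max_right δ δ⁻¹
      rcases lt_or_ge t (min δ δ⁻¹ / 4) with h | h
      · simp only [hq]
        rw [scaledProfile_of_le hδ (by linarith), scaledProfile_of_le hR (by linarith), sub_zero]
      · have h' : max δ δ⁻¹ < t := by
          by_contra h'
          exact ht ⟨h, not_lt.1 h'⟩
        simp only [hq]
        rw [scaledProfile_of_ge hδ (by linarith), scaledProfile_of_ge hR (by linarith), sub_self]
    have hqb : ∀ t, |q t| ≤ 1 := fun t => by
      have h1 := scaledProfile_mem_Icc δ t
      have h2 := scaledProfile_mem_Icc δ⁻¹ t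
      rw [abs_le]
      constructor <;> simp only [hq] <;> linarith [h1.1, h1.2, h2.1, h2.2]
    have hqd : ∀ t, deriv q t = deriv (scaledProfile δ) t - deriv (scaledProfile δ⁻¹) t :=
      fun t => deriv_fun_sub ((contDiff_scaledProfile δ).differentiable one_ne_zero t)
        ((contDiff_scaledProfile δ⁻¹).differentiable one_ne_zero t)
    have hΨ1 : ContDiff ℝ 1 fun p : EuclideanSpace ℝ (Fin n) × ℝ => q p.2 * H p.1 :=
      (hq1.comp contDiff_snd).mul (hH.comp contDiff_fst)
    have htest := isTestField_normalField hΨ1 (hasCompactSupport_mul_prod hq0 hHc)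
      (tsupport_mul_prod_subset hq0 H) fun p => by
        rw [abs_mul]
        exact mul_le_one₀ (hqb _) (abs_nonneg _) (hHb _)
    have h1 := (htest.mono (V := halfSpace n) fun x hx =>
      lt_of_lt_of_le (by positivity) hx.2.1).integral_le hfin
    rw [integral_divergence_normalField w hΨ1] at h1
    simp only [fderiv_mul_prod hq1 hH, hqd] at h1
    have b : ∀ {ε : ℝ}, 0 < ε → Integrable (fun p : EuclideanSpace ℝ (Fin n) × ℝ =>
        w (prodEquiv n p) * deriv (scaledProfile ε) p.2 * H p.1) (volume.prod volume) := fun hε =>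
      (integrable_mul_deriv_scaledProfile hv hε).mul_bdd (c := 1)
        (hH.continuous.comp continuous_fst).aestronglyMeasurable
        (Eventually.of_forall fun p => hHb p.1)
    have e1 : ∫ p, w (prodEquiv n p) *
        ((deriv (scaledProfile δ) p.2 - deriv (scaledProfile δ⁻¹) p.2) * H p.1)
          ∂(volume.prod volume)
        = ∫ p, w (prodEquiv n p) * deriv (scaledProfile δ) p.2 * H p.1 ∂(volume.prod volume)
          - ∫ p, w (prodEquiv n p) * deriv (scaledProfile δ⁻¹) p.2 * H p.1
            ∂(volume.prod volume) := by
      rw [← integral_sub (b hδ) (b hR)]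
      refine integral_congr_ae (Eventually.of_forall fun p => ?_)
      simp only
      ring
    rw [e1] at h1
    have h2 : ∫ p, w (prodEquiv n p) * deriv (scaledProfile δ⁻¹) p.2 * H p.1
        ∂(volume.prod volume) ≤ C * δ * I := by
      rw [hI, ← integral_const_mul]
      refine integral_mono (b hR) (hv.abs.const_mul _) fun p => (le_abs_self _).trans ?_
      simp only
      rw [abs_mul, abs_mul, abs_of_nonneg (deriv_scaledProfile_nonneg hR _), deriv_scaledProfile,
        div_inv_eq_mul, mul_comm (C * δ)]
      refine (mul_le_of_le_one_right (mul_nonneg (abs_nonneg _)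
        (mul_nonneg (deriv_profile_nonneg _) hδ.le)) (hHb _)).trans ?_
      exact mul_le_mul_of_nonneg_left (mul_le_mul_of_nonneg_right (hC _) hδ.le) (abs_nonneg _)
    have h3 := (abs_le.1 (hTw.abs_integral_sub_le hw hT hC hH.continuous hHb hδ)).1
    linarith
  have hid : Tendsto (fun δ : ℝ => δ) (𝓝[>] 0) (𝓝 0) := tendsto_id.mono_left nhdsWithin_le_nhds
  have hlim := (((tendsto_variation_boundaryLayer hw hfin).const_mul C).add
    ((hid.const_mul C).mul_const I)).const_add (variation w (halfSpace n)).toReal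
  simp only [mul_zero, zero_mul, add_zero] at hlim
  refine ge_of_tendsto hlim ?_
  filter_upwards [self_mem_nhdsWithin] with δ hδ using hbound δ hδ

theorem fderiv_scaledProfile_last (δ : ℝ) (x y : EuclideanSpace ℝ (Fin (n + 1))) :
    fderiv ℝ (fun x : EuclideanSpace ℝ (Fin (n + 1)) => scaledProfile δ (x (Fin.last n))) x y
      = deriv (scaledProfile δ) (x (Fin.last n)) * y (Fin.last n) := by
  have h1 : HasDerivAt (scaledProfile δ) (deriv (scaledProfile δ) (x (Fin.last n)))
      (x (Fin.last n)) :=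
    ((contDiff_scaledProfile δ).differentiable one_ne_zero _).hasDerivAt
  have h2 : HasFDerivAt (fun x : EuclideanSpace ℝ (Fin (n + 1)) => x (Fin.last n))
      (EuclideanSpace.proj (Fin.last n) : EuclideanSpace ℝ (Fin (n + 1)) →L[ℝ] ℝ) x :=
    (EuclideanSpace.proj (Fin.last n) : EuclideanSpace ℝ (Fin (n + 1)) →L[ℝ] ℝ).hasFDerivAt
  have h3 := h1.comp_hasFDerivAt x h2
  have h4 : HasFDerivAt (fun x : EuclideanSpace ℝ (Fin (n + 1)) =>
    scaledProfile δ (x (Fin.last n))) _ x := h3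
  rw [h4.fderiv]
  simp

theorem contDiff_scaledProfile_last (δ : ℝ) :
    ContDiff ℝ 1 fun x : EuclideanSpace ℝ (Fin (n + 1)) => scaledProfile δ (x (Fin.last n)) :=
  (contDiff_scaledProfile δ).comp
    (EuclideanSpace.proj (Fin.last n) : EuclideanSpace ℝ (Fin (n + 1)) →L[ℝ] ℝ).contDiff

theorem IsTestField.scaledProfile_smul {U : Set (EuclideanSpace ℝ (Fin (n + 1)))}
    {g : EuclideanSpace ℝ (Fin (n + 1)) → EuclideanSpace ℝ (Fin (n + 1))} (hg : IsTestField U g)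
    {δ : ℝ} (hδ : 0 < δ) :
    IsTestField (halfSpace n) fun x => scaledProfile δ (x (Fin.last n)) • g x := by
  have hsub : tsupport (fun x => scaledProfile δ (x (Fin.last n)) • g x)
      ⊆ {x | δ / 4 ≤ x (Fin.last n)} := by
    refine closure_minimal (fun x hx => ?_) (isClosed_le continuous_const (by fun_prop))
    by_contra h
    exact hx (by simp [scaledProfile_of_le hδ (not_le.1 h).le])
  refine ⟨(contDiff_scaledProfile_last δ).smul hg.1,
    hg.2.1.mono fun x hx h => hx (by simp [h]),
    fun x hx => lt_of_lt_of_le (by positivity : 0 < δ / 4) (hsub hx), fun x => ?_⟩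
  have := scaledProfile_mem_Icc δ (x (Fin.last n))
  rw [norm_smul, Real.norm_eq_abs, abs_of_nonneg this.1]
  exact mul_le_one₀ this.2 (norm_nonneg _) (hg.2.2.2 x)

theorem IsBoundaryValue.integral_abs_mul_deriv_le (hTw : IsBoundaryValue w T) (hw : Integrable w)
    (hT : Integrable T) (hC : ∀ t, deriv profile t ≤ C) {δ : ℝ} (hδ : 0 < δ) :
    ∫ p, |w (prodEquiv n p)| * deriv (scaledProfile δ) p.2 ∂(volume.prod volume)
      ≤ (∫ x, |T x|) + C * (variation w (cylinder univ δ)).toReal := by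
  have hv := integrable_comp_prodEquiv hw
  have iA := (hv.integrableOn (s := univ ×ˢ Ioo 0 δ)).abs
  have iB : IntegrableOn (fun p => |w (prodEquiv n p) - T p.1|) (univ ×ˢ Ioo 0 δ)
      (volume.prod volume) :=
    (hv.integrableOn.sub (integrableOn_comp_fst hT _ _)).abs
  have iC := integrableOn_comp_fst hT.abs univ δ
  calc ∫ p, |w (prodEquiv n p)| * deriv (scaledProfile δ) p.2 ∂(volume.prod volume)
      = ∫ p in univ ×ˢ Ioo 0 δ, |w (prodEquiv n p)| * deriv (scaledProfile δ) p.2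
          ∂(volume.prod volume) :=
        (setIntegral_eq_integral_mul_deriv_scaledProfile
          (fun p => |w (prodEquiv n p)|) hδ).symm
    _ ≤ ∫ p in univ ×ˢ Ioo 0 δ, (|T p.1| * deriv (scaledProfile δ) p.2
          + |w (prodEquiv n p) - T p.1| * deriv (scaledProfile δ) p.2)
          ∂(volume.prod volume) := by
        refine integral_mono (integrable_mul_deriv_scaledProfile iA hδ)
          ((integrable_mul_deriv_scaledProfile iC hδ).add
            (integrable_mul_deriv_scaledProfile iB hδ)) fun p => ?_
        simp only
        rw [← add_mul]
        refine mul_le_mul_of_nonneg_right ?_ (deriv_scaledProfile_nonneg hδ _)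
        have := abs_add_le (T p.1) (w (prodEquiv n p) - T p.1)
        rwa [add_sub_cancel] at this
    _ ≤ _ := by
        rw [integral_add (integrable_mul_deriv_scaledProfile iC hδ)
          (integrable_mul_deriv_scaledProfile iB hδ),
          setIntegral_mul_deriv_scaledProfile (fun x => |T x|) hδ]
        gcongr
        exact hTw.setIntegral_le hw hT hC hδ

theorem tendsto_integral_one_sub_scaledProfile_mul {f : EuclideanSpace ℝ (Fin (n + 1)) → ℝ}
    (hf : Integrable f) (hf0 : ∀ x ∉ halfSpace n, f x = 0) :
    Tendsto (fun δ => ∫ x, (1 - scaledProfile δ (x (Fin.last n))) * f x) (𝓝[>] 0) (𝓝 0) := by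
  suffices h : Tendsto (fun δ => ∫ x, (1 - scaledProfile δ (x (Fin.last n))) * f x) (𝓝[>] 0)
      (𝓝 (∫ _ : EuclideanSpace ℝ (Fin (n + 1)), (0 : ℝ))) by simpa using h
  refine tendsto_integral_filter_of_dominated_convergence (fun x => |f x|) ?_ ?_ hf.abs ?_
  · exact Eventually.of_forall fun δ => (continuous_const.sub
      (contDiff_scaledProfile_last δ).continuous).aestronglyMeasurable.mul hf.aestronglyMeasurable
  · refine Eventually.of_forall fun δ => Eventually.of_forall fun x => ?_
    have := scaledProfile_mem_Icc δ (x (Fin.last n))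
    rw [norm_mul, Real.norm_eq_abs, Real.norm_eq_abs]
    refine mul_le_of_le_one_left (abs_nonneg _) ?_
    rw [abs_le]
    constructor <;> linarith [this.1, this.2]
  · refine Eventually.of_forall fun x => ?_
    by_cases hx : x ∈ halfSpace n
    · refine tendsto_const_nhds.congr' ?_
      have hx' : 0 < x (Fin.last n) := hx
      filter_upwards [Ioo_mem_nhdsGT hx'] with δ hδ
      simp [scaledProfile_of_ge hδ.1 (by linarith [hδ.2, hδ.1] :
        3 * δ / 4 ≤ x (Fin.last n))]
    · simp [hf0 x hx]

/-- Extending by zero creates at most the mass of the boundary value on the boundary: a test field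
`g` is split as `P(t / δ) g + (1 - P(t / δ)) g`, where the first part is admissible in the
half-space and the divergence of the second concentrates on the boundary. -/
theorem IsBoundaryValue.variation_univ_le (hTw : IsBoundaryValue w T) (hw : Integrable w)
    (hw0 : ∀ x ∉ halfSpace n, w x = 0) (hT : Integrable T)
    (hfin : variation w (halfSpace n) ≠ ∞) :
    variation w univ ≤ ENNReal.ofReal ((variation w (halfSpace n)).toReal + ∫ x, |T x|) := by
  obtain ⟨C, hC0, hC⟩ := exists_deriv_profile_le
  have hv := integrable_comp_prodEquiv hw
  refine variation_le_iff.2 fun g hg => ENNReal.ofReal_le_ofReal ?_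
  have hwg := hg.integrable hw
  have hgl : ∀ x, |g x (Fin.last n)| ≤ 1 := fun x =>
    (PiLp.norm_apply_le (g x) (Fin.last n)).trans (hg.2.2.2 x)
  have hgc : Continuous fun x => g x (Fin.last n) := by
    have := hg.1.continuous
    fun_prop
  have hbound : ∀ δ > 0, ∫ x, w x * divergence g x ≤
      (variation w (halfSpace n)).toReal
      + ((∫ x, (1 - scaledProfile δ (x (Fin.last n))) * (w x * divergence g x)) + ((∫ x, |T x|)
        + C * (variation w (cylinder (univ : Set (EuclideanSpace ℝ (Fin n))) δ)).toReal)) := by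
    intro δ hδ
    have h1 := (hg.scaledProfile_smul hδ).integral_le hfin
    set D : EuclideanSpace ℝ (Fin (n + 1)) → ℝ := fun x =>
      w x * deriv (scaledProfile δ) (x (Fin.last n)) * g x (Fin.last n) with hD
    have hDp : Integrable (fun p => D (prodEquiv n p)) (volume.prod volume) := by
      simp only [hD, prodEquiv_last]
      exact (integrable_mul_deriv_scaledProfile hv hδ).mul_bdd (c := 1)
        (hgc.comp (prodEquiv n).continuous).aestronglyMeasurable
        (Eventually.of_forall fun p => hgl _)
    have hDi : Integrable D :=
      (measurePreserving_prodEquiv.integrable_comp_emb measurableEmbedding_prodEquiv).1 hDp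
    have hEi : Integrable fun x =>
        (1 - scaledProfile δ (x (Fin.last n))) * (w x * divergence g x) := by
      refine hwg.bdd_mul (c := 1)
        (continuous_const.sub (contDiff_scaledProfile_last δ).continuous).aestronglyMeasurable
        (Eventually.of_forall fun x => ?_)
      have := scaledProfile_mem_Icc δ (x (Fin.last n))
      rw [Real.norm_eq_abs, abs_le]
      constructor <;> linarith [this.1, this.2]
    have hsplit : ∫ x, w x * divergence (fun x => scaledProfile δ (x (Fin.last n)) • g x) x
        = (∫ x, w x * divergence g x)
          - (∫ x, (1 - scaledProfile δ (x (Fin.last n))) * (w x * divergence g x))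
          + ∫ x, D x := by
      rw [← integral_sub hwg hEi, ← integral_add (by exact hwg.sub hEi) hDi]
      refine integral_congr_ae (Eventually.of_forall fun x => ?_)
      simp only [divergence_smul (contDiff_scaledProfile_last δ) hg.1, hD,
        fderiv_scaledProfile_last]
      ring
    have h2 : -∫ x, D x ≤ ∫ p, |w (prodEquiv n p)| * deriv (scaledProfile δ) p.2
        ∂(volume.prod volume) := by
      rw [← integral_comp_prodEquiv, ← integral_neg]
      refine integral_mono hDp.neg (integrable_mul_deriv_scaledProfile hv.abs hδ) fun p => ?_
      refine (neg_le_abs _).trans ?_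
      simp only [hD, prodEquiv_last]
      rw [abs_mul, abs_mul, abs_of_nonneg (deriv_scaledProfile_nonneg hδ _)]
      exact mul_le_of_le_one_right
        (mul_nonneg (abs_nonneg _) (deriv_scaledProfile_nonneg hδ _)) (hgl _)
    have h3 := hTw.integral_abs_mul_deriv_le hw hT hC hδ
    rw [hsplit] at h1
    linarith
  have hlim := ((tendsto_integral_one_sub_scaledProfile_mul hwg
    (fun x hx => by rw [hw0 x hx, zero_mul])).add
    (((tendsto_variation_boundaryLayer hw hfin).const_mul C).const_add
      (∫ x, |T x|))).const_add (variation w (halfSpace n)).toReal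
  simp only [mul_zero, zero_add, add_zero] at hlim
  refine ge_of_tendsto hlim ?_
  filter_upwards [self_mem_nhdsWithin] with δ hδ using hbound δ hδ

/-- Extending by zero creates at least the mass of the boundary value on the boundary: a nearly
optimal test field in the half-space vanishes near the boundary, so that a test field concentrated
near the boundary can be added to it. -/
theorem IsBoundaryValue.add_le_variation_univ (hTw : IsBoundaryValue w T) (hw : Integrable w)
    (hw0 : ∀ x ∉ halfSpace n, w x = 0) (hT : Integrable T)
    (hfin : variation w univ ≠ ∞) :
    (variation w (halfSpace n)).toReal + ∫ x, |T x| ≤ (variation w univ).toReal := by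
  obtain ⟨C, hC0, hC⟩ := exists_deriv_profile_le
  have hfin' : variation w (halfSpace n) ≠ ∞ :=
    ne_top_of_le_ne_top hfin (variation_mono w (subset_univ _))
  refine le_of_forall_pos_le_add fun ε hε => ?_
  obtain ⟨g, hg, hgV⟩ := exists_isTestField_lt hfin' hε
  obtain ⟨a, ha, haK⟩ := exists_pos_le_of_isCompact hg.2.1 hg.2.2.1
  suffices h : ∫ x, |T x| ≤ (variation w univ).toReal - ∫ x, w x * divergence g x by linarith
  rw [← setIntegral_univ]
  refine integral_abs_le_of_forall_contDiff isOpen_univ hT.integrableOn ?_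
  intro H hH hHc _ hHb
  rw [setIntegral_univ]
  have hbound : ∀ δ ∈ Ioo 0 a, ∫ x, T x * H x ≤ ((variation w univ).toReal
      - ∫ x, w x * divergence g x)
      + C * (variation w (cylinder (univ : Set (EuclideanSpace ℝ (Fin n))) δ)).toReal := by
    rintro δ ⟨hδ, hδa⟩
    -- the shifted profile only makes the support compact: it is constant where `w ≠ 0`
    set q : ℝ → ℝ := fun t => scaledProfile δ t - scaledProfile 1 (t + 1) with hq
    have hs1 : ContDiff ℝ 1 fun t : ℝ => scaledProfile 1 (t + 1) :=
      (contDiff_scaledProfile 1).comp (contDiff_id.add contDiff_const)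
    have hq1 : ContDiff ℝ 1 q := (contDiff_scaledProfile δ).sub hs1
    have hq0 : ∀ t ∉ Icc (-1) (3 * δ / 4), q t = 0 := by
      intro t ht
      rcases lt_or_ge t (-1) with h | h
      · simp only [hq]
        rw [scaledProfile_of_le hδ (by linarith), scaledProfile_of_le one_pos (by linarith),
          sub_zero]
      · have h' : 3 * δ / 4 < t := by
          by_contra h'
          exact ht ⟨h, not_lt.1 h'⟩
        simp only [hq]
        rw [scaledProfile_of_ge hδ (by linarith), scaledProfile_of_ge one_pos (by linarith),
          sub_self]
    have hqb : ∀ t, |q t| ≤ 1 := fun t => by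
      have h1 := scaledProfile_mem_Icc δ t
      have h2 := scaledProfile_mem_Icc 1 (t + 1)
      rw [abs_le]
      constructor <;> simp only [hq] <;> linarith [h1.1, h1.2, h2.1, h2.2]
    have hqd : ∀ t, 0 < t → deriv q t = deriv (scaledProfile δ) t := by
      intro t ht
      have h1 : deriv (fun t : ℝ => scaledProfile 1 (t + 1)) t = 0 := by
        rw [deriv_comp_add_const, deriv_scaledProfile_eq_zero one_pos]
        exact fun h => by linarith [h.2]
      simp only [hq]
      rw [deriv_fun_sub ((contDiff_scaledProfile δ).differentiable one_ne_zero t)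
        (hs1.differentiable one_ne_zero t), h1, sub_zero]
    have hΨ1 : ContDiff ℝ 1 fun p : EuclideanSpace ℝ (Fin n) × ℝ => q p.2 * H p.1 :=
      (hq1.comp contDiff_snd).mul (hH.comp contDiff_fst)
    have htest := isTestField_normalField hΨ1 (hasCompactSupport_mul_prod hq0 hHc)
      (tsupport_mul_prod_subset hq0 H) fun p => by
        rw [abs_mul]
        exact mul_le_one₀ (hqb _) (abs_nonneg _) (hHb _)
    have hdisj : Disjoint (tsupport g)
        (tsupport (normalField fun p : EuclideanSpace ℝ (Fin n) × ℝ => q p.2 * H p.1)) := by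
      rw [disjoint_left]
      intro x hx hx'
      have h1 := haK x hx
      have h2 : x (Fin.last n) ≤ 3 * δ / 4 := (htest.2.2.1 hx').2.2
      linarith
    have h1 := ((hg.add htest hdisj).mono (subset_univ _)).integral_le hfin
    simp only [divergence_add hg.1 htest.1, mul_add] at h1
    rw [integral_add (hg.integrable hw) (htest.integrable hw),
      integral_divergence_normalField w hΨ1] at h1
    have e1 : ∫ p, w (prodEquiv n p) *
        fderiv ℝ (fun p : EuclideanSpace ℝ (Fin n) × ℝ => q p.2 * H p.1) p (0, 1)
          ∂(volume.prod volume)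
        = ∫ p, w (prodEquiv n p) * deriv (scaledProfile δ) p.2 * H p.1
          ∂(volume.prod volume) := by
      refine integral_congr_ae (Eventually.of_forall fun p => ?_)
      simp only [fderiv_mul_prod hq1 hH]
      by_cases hp : 0 < p.2
      · rw [hqd _ hp, mul_assoc]
      · rw [hw0 (prodEquiv n p) (by simpa [halfSpace] using hp), zero_mul, zero_mul, zero_mul]
    rw [e1] at h1
    have h3 := (abs_le.1 (hTw.abs_integral_sub_le hw hT hC hH.continuous hHb hδ)).1
    linarith
  have hlim := ((tendsto_variation_boundaryLayer hw hfin').const_mul C).const_add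
    ((variation w univ).toReal - ∫ x, w x * divergence g x)
  rw [mul_zero, add_zero] at hlim
  refine ge_of_tendsto hlim ?_
  filter_upwards [Ioo_mem_nhdsGT ha] with δ hδ using hbound δ hδ

/-- A function supported in the open half-space has the same variation in every neighbourhood of
the closed half-space. -/
theorem variation_eq_of_closure_subset (hw0 : ∀ x ∉ halfSpace n, w x = 0)
    {U : Set (EuclideanSpace ℝ (Fin (n + 1)))} (hU : IsOpen U)
    (hsub : closure (halfSpace n) ⊆ U) : variation w U = variation w univ := by
  refine le_antisymm (variation_mono w (subset_univ _)) (variation_le_iff.2 fun g hg => ?_)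
  obtain ⟨η, h1, h2, h3, h4, h5⟩ := exists_smooth_cutoff
    (hg.2.1.isCompact.inter_right (isClosed_closure (s := halfSpace n))) hU
    (inter_subset_right.trans hsub)
  have htest : IsTestField U fun x => η x • g x := by
    refine ⟨h1.smul hg.1, h2.smul_right, (tsupport_smul_subset_left η g).trans h3, fun x => ?_⟩
    rw [norm_smul, Real.norm_eq_abs, abs_of_nonneg (h4 x).1]
    exact mul_le_one₀ (h4 x).2 (norm_nonneg _) (hg.2.2.2 x)
  have heq : ∫ x, w x * divergence g x = ∫ x, w x * divergence (fun x => η x • g x) x := by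
    refine integral_congr_ae (Eventually.of_forall fun x => ?_)
    simp only
    by_cases hx : x ∈ halfSpace n
    · by_cases hxg : x ∈ tsupport g
      · rw [divergence_congr (g := g) (g' := fun x => η x • g x)]
        filter_upwards [h5 x ⟨hxg, subset_closure hx⟩] with y hy
        rw [hy, one_smul]
      · rw [divergence_eq_zero_of_notMem_tsupport hxg,
          divergence_eq_zero_of_notMem_tsupport fun h =>
            hxg (tsupport_smul_subset_right η g h)]
    · rw [hw0 x hx, zero_mul, zero_mul]
  rw [heq]
  exact htest.ofReal_integral_le w

end Gluing

/-! ### Functions of bounded variation on the half-space -/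

section BV

variable {n : ℕ} {u : EuclideanSpace ℝ (Fin (n + 1)) → ℝ}

/-- A function of bounded variation on the half-space has an integrable trace, whose mass is at
most the variation in the half-space and is exactly the variation which the extension by zero
gains at the boundary. -/
theorem MemBV.trace_spec (hu : MemBV u (halfSpace n)) :
    HasIntegrableTrace u ∧
      ∫ x, |trace u x| ≤ (variation u (halfSpace n)).toReal ∧
      variation ((halfSpace n).indicator u) univ < ∞ ∧
      (variation ((halfSpace n).indicator u) univ).toReal
        = (variation u (halfSpace n)).toReal + ∫ x, |trace u x| := by
  have hm : MeasurableSet (halfSpace n) := isOpen_halfSpace.measurableSet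
  set w := (halfSpace n).indicator u with hwdef
  have hw : Integrable w := (integrable_indicator_iff hm).2 hu.1
  have hw0 : ∀ x ∉ halfSpace n, w x = 0 := fun x hx => indicator_of_notMem hx u
  have heq : EqOn w u (halfSpace n) := fun x hx => indicator_of_mem hx u
  have hvar : variation w (halfSpace n) = variation u (halfSpace n) := variation_congr hm heq
  have hfin : variation w (halfSpace n) ≠ ∞ := by
    rw [hvar]
    exact hu.2.ne
  obtain ⟨T, hT, hTw⟩ := exists_boundary_limit hw hfin
  have hlim : ∀ᵐ x : EuclideanSpace ℝ (Fin n), Tendsto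
      (fun r : ℝ => ⨍ z in Metric.ball (toBoundary x) r ∩ halfSpace n, u z)
      (𝓝[>] (0 : ℝ)) (𝓝 (T x)) := by
    filter_upwards [ae_tendsto_average_halfBall hw hfin hT hTw] with x hx
    refine hx.congr fun r => ?_
    rw [setAverage_eq, setAverage_eq,
      setIntegral_congr_fun (Metric.isOpen_ball.measurableSet.inter hm) fun z hz => heq hz.2]
  have htr : trace u =ᵐ[volume] T := by
    filter_upwards [hlim] with x hx using hx.limUnder_eq
  have htrace : HasIntegrableTrace u := by
    refine ⟨?_, hT.congr htr.symm⟩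
    filter_upwards [hlim, htr] with x hx hx'
    rwa [hx']
  have hint : ∫ x, |trace u x| = ∫ x, |T x| := integral_congr_ae (htr.fun_comp abs)
  have hTb : IsBoundaryValue w T := hTw univ isOpen_univ
  have hle := hTb.variation_univ_le hw hw0 hT hfin
  have hfin' : variation w univ < ∞ := hle.trans_lt ENNReal.ofReal_lt_top
  rw [hint, ← hvar]
  have hnn : 0 ≤ ∫ x, |T x| := integral_nonneg fun _ => abs_nonneg _
  exact ⟨htrace, hTb.integral_abs_le hw hT hfin, hfin',
    le_antisymm (ENNReal.toReal_le_of_le_ofReal (by positivity) hle)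
      (hTb.add_le_variation_univ hw hw0 hT hfin'.ne)⟩

theorem closedVariation_eq (u : EuclideanSpace ℝ (Fin (n + 1)) → ℝ) :
    closedVariation u = variation ((halfSpace n).indicator u) univ := by
  refine le_antisymm (iInf₂_le_of_le univ isOpen_univ (iInf_le _ (subset_univ _))) ?_
  refine le_iInf₂ fun U hU => le_iInf fun hsub => ?_
  rw [variation_eq_of_closure_subset (fun x hx => indicator_of_notMem hx u) hU hsub]

theorem HasIntegrableTrace.nonneg_ae (h : HasIntegrableTrace u) (hu : 0 ≤ u) :
    0 ≤ᵐ[volume] trace u := by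
  filter_upwards [h.1] with x hx
  refine ge_of_tendsto' hx fun r => ?_
  rw [setAverage_eq]
  exact smul_nonneg (inv_nonneg.2 measureReal_nonneg) (integral_nonneg hu)

end BV

end Capillary

theorem mainTheorem12 (n : ℕ) (β : EuclideanSpace ℝ (Fin n) → ℝ) (hβ : MemLp β ∞ volume) :
    -- the capillary functional on sets of finite perimeter
    (∀ κ ∈ Set.Icc (0 : ℝ) (1 / 2),
      (∀ᵐ x ∂(volume : Measure (EuclideanSpace ℝ (Fin n))), -1 ≤ β x ∧ β x ≤ 1 - 2 * κ) →
      ∀ E : Set (EuclideanSpace ℝ (Fin (n + 1))),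
        Capillary.MemBVSet E (Capillary.halfSpace n) →
        Capillary.HasIntegrableTrace (Capillary.chi E) ∧
        Capillary.perimeter E Set.univ < ∞ ∧
        κ * (Capillary.perimeter E Set.univ).toReal ≤ Capillary.capillary β E ∧
        Capillary.capillary β E ≤ (Capillary.perimeter E Set.univ).toReal) ∧
    -- the level-set functional
    (∀ κ ∈ Set.Icc (0 : ℝ) (1 / 2),
      eLpNorm β ∞ volume ≤ ENNReal.ofReal (1 - 2 * κ) →
      ∀ u : EuclideanSpace ℝ (Fin (n + 1)) → ℝ,
        Capillary.MemBV u (Capillary.halfSpace n) →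
        Capillary.HasIntegrableTrace u ∧
        Capillary.closedVariation u < ∞ ∧
        κ * (Capillary.closedVariation u).toReal ≤ Capillary.levelSetCapillary β u ∧
        Capillary.levelSetCapillary β u ≤ (Capillary.closedVariation u).toReal) := by

  have hβi : ∀ {T : EuclideanSpace ℝ (Fin n) → ℝ}, Integrable T →
      Integrable fun x => β x * T x := fun hT => hT.mul_of_top_right hβ
  refine ⟨fun κ hκ hβκ E hE => ?_, fun κ hκ hβκ u hu => ?_⟩
  · obtain ⟨htr, hle, hfin, heq⟩ := hE.2.trace_spec
    have hind : (Capillary.halfSpace n).indicator (Capillary.chi E) = Capillary.chi E := by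
      rw [Set.indicator_eq_self]
      intro x hx
      by_contra h
      exact hx (Set.indicator_of_notMem (fun hxE => h (hE.1 hxE)) _)
    rw [hind] at hfin heq
    have hnn := htr.nonneg_ae fun x => Set.indicator_nonneg (fun _ _ => zero_le_one) x
    have habs : ∫ x, |Capillary.trace (Capillary.chi E) x|
        = ∫ x, Capillary.trace (Capillary.chi E) x := by
      refine integral_congr_ae ?_
      filter_upwards [hnn] with x hx using abs_of_nonneg hx
    rw [habs] at heq hle
    have h1 : ∫ x, β x * Capillary.trace (Capillary.chi E) x
        ≤ (1 - 2 * κ) * ∫ x, Capillary.trace (Capillary.chi E) x := by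
      rw [← integral_const_mul]
      refine integral_mono_ae (hβi htr.2) (htr.2.const_mul _) ?_
      filter_upwards [hnn, hβκ] with x hx hb using mul_le_mul_of_nonneg_right hb.2 hx
    have h2 : -∫ x, Capillary.trace (Capillary.chi E) x
        ≤ ∫ x, β x * Capillary.trace (Capillary.chi E) x := by
      rw [← integral_neg]
      refine integral_mono_ae htr.2.neg (hβi htr.2) ?_
      filter_upwards [hnn, hβκ] with x hx hb
      have := mul_le_mul_of_nonneg_right hb.1 hx
      simpa using this
    refine ⟨htr, hfin, ?_, ?_⟩
    · simp only [Capillary.capillary, Capillary.perimeter]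
      rw [heq]
      -- the surplus is `(1 - κ) (P(E, Ω) - ∫ χ_E) ≥ 0`
      nlinarith [mul_nonneg (by linarith [hκ.2] : (0 : ℝ) ≤ 1 - κ) (sub_nonneg.2 hle)]
    · simp only [Capillary.capillary, Capillary.perimeter]
      rw [heq]
      linarith
  · obtain ⟨htr, hle, hfin, heq⟩ := hu.trace_spec
    have hκ0 : 0 ≤ 1 - 2 * κ := by linarith [hκ.2]
    have hb : ∀ᵐ x, |β x| ≤ 1 - 2 * κ := by
      filter_upwards [ae_le_eLpNormEssSup (f := β) (μ := volume)] with x hx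
      rw [eLpNorm_exponent_top] at hβκ
      have := hx.trans hβκ
      rwa [← ofReal_norm, ENNReal.ofReal_le_ofReal_iff hκ0, Real.norm_eq_abs] at this
    have habs : |∫ x, β x * Capillary.trace u x|
        ≤ (1 - 2 * κ) * ∫ x, |Capillary.trace u x| := by
      rw [← integral_const_mul]
      refine abs_integral_le_integral_abs.trans
        (integral_mono_ae (hβi htr.2).abs (htr.2.abs.const_mul _) ?_)
      filter_upwards [hb] with x hx
      rw [abs_mul]
      exact mul_le_mul_of_nonneg_right hx (abs_nonneg _)
    have hA : 0 ≤ ∫ x, |Capillary.trace u x| := integral_nonneg fun _ => abs_nonneg _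
    rw [abs_le] at habs
    rw [Capillary.closedVariation_eq]
    refine ⟨htr, hfin, ?_, ?_⟩
    · simp only [Capillary.levelSetCapillary]
      rw [heq]
      -- the surplus is `(1 - κ) (∫_Ω |Du| - ∫ |u|) ≥ 0`
      nlinarith [mul_nonneg (by linarith [hκ.2] : (0 : ℝ) ≤ 1 - κ) (sub_nonneg.2 hle)]
    · simp only [Capillary.levelSetCapillary]
      rw [heq]
      nlinarith [mul_nonneg hκ.1 hA]
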